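/- **Conventions.** A *unitary category* is a $\mathbb{C}$-linear category with an operation $\delta$ that fixes objects, reverses morphisms, and is antilinear, involutive, compatible with composition and identities, and positive ($f\circ\delta(f)=0\Rightarrow f=0$). A morphism $f$ is *unitary* if $\delta(f)=f^{-1}$; a functor is *unitary* if it is $\mathbb{C}$-linear and commutes with $\delta$. A unitary category is *finite* if it has finite orthogonal direct sums, split idempotents and finite-dimensional Hom spaces and is semisimple with finitely many simple objects up to isomorphism. A *unitary multi-fusion category* $\mathcal{P}$ is a finite unitary category with a rigid monoidal structure whose tensor product is bilinear and compatible with $\delta$ and whose associators and unitors are unitary (the unit $\mathbf{1}$ need not be simple). Let $\Sigma\mathcal{P}$ be the 2-category of finite unitary right $\mathcal{P}$-module categories (bilinear actions $\odot$ compatible with $\delta$, with unitary coherence isomorphisms), unitary $\mathcal{P}$-module functors (unitary functors $F$ with unitary module structure isomorphisms $F(x)\odot p\simeq F(x\odot p)$) and $\mathcal{P}$-module natural transformations. It is a unitary 2-category, with $\delta$ taken componentwise on 2-morphisms. For a unitary 2-category $\mathcal{S}$ let $\mathfrak{Z}_0(\mathcal{S})$ be the 2-category of unitary 2-functors $\mathcal{S}\to\mathcal{S}$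 (pseudofunctors, $\mathbb{C}$-linear and commuting with $\delta$ on 2-morphisms, with unitary coherence isomorphisms), unitary pseudonatural transformations (those with unitary naturality isomorphisms) and modifications. Let $\Omega(\mathfrak{Z}_0(\mathcal{S}))$ be the unitary category of endomorphisms of the identity 2-functor: its tensor product $\phi\otimes\psi$ is the composition with component "first $\phi_X$, then $\psi_X$", and the component at $X$ of its braiding $\phi\otimes\psi\simeq\psi\otimes\phi$ is the naturality isomorphism of $\psi$ at the 1-morphism $\phi_X\colon X\to X$. Let $\mathfrak{Z}_1(\mathcal{P})$ be the Drinfeld center: the unitary braided monoidal category of pairs $(z,\beta)$ of an object $z$ of $\mathcal{P}$ and a unitary half-braiding $\beta_p\colon z\otimes p\simeq p\otimes z$, with braiding $\beta_w\colon (z,\beta)\otimes(w,\gamma)\simeq (w,\gamma)\otimes(z,\beta)$. **Proposition.** Let $\mathcal{P}$ be a unitary multi-fusion category. For $(z,\beta)\in\mathfrak{Z}_1(\mathcal{P})$ and $\mathcal{X}\in\Sigma\mathcal{P}$, the functor $-\odot z\colon\mathcal{X}\to\mathcal{X}$ is a unitary $\mathcal{P}$-module functor, with module structure $$(x\odot z)\odot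 p\simeq x\odot(z\otimes p)\xrightarrow{\,x\odot\beta_p\,}x\odot(p\otimes z)\simeq(x\odot p)\odot z .$$ The family $\{-\odot z\}_{\mathcal{X}}$, whose naturality isomorphism at a module functor $G$ is the module structure $G(x)\odot z\simeq G(x\odot z)$, is an object of $\Omega(\mathfrak{Z}_0(\Sigma\mathcal{P}))$. The resulting functor $$\Theta\colon\mathfrak{Z}_1(\mathcal{P})\to\Omega(\mathfrak{Z}_0(\Sigma\mathcal{P})),\qquad (z,\beta)\mapsto\{-\odot z\}_{\mathcal{X}\in\Sigma\mathcal{P}},\qquad f\mapsto\{x\odot f\}_{\mathcal X,\,x\in\mathcal X},$$ is unitary, is an equivalence of categories, and is braided monoidal, with monoidal structure given by the module coherence isomorphisms $(x\odot z)\odot w\simeq x\odot(z\otimes w)$ and $x\simeq x\odot\mathbf{1}$. A quasi-inverse is the functor $\phi\mapsto\phi_{\mathcal{P}}(\mathbf{1})$, where $\phi_{\mathcal{P}}(\mathbf{1})$ carries the half-braiding $$\phi_{\mathcal{P}}(\mathbf{1})\otimes p\simeq\phi_{\mathcal{P}}(\mathbf{1}\otimes p)\simeq\phi_{\mathcal{P}}(p\otimes\mathbf{1})\simeq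 p\otimes\phi_{\mathcal{P}}(\mathbf{1})$$ given by the module structure of $\phi_{\mathcal{P}}$, the unitors, and the naturality of $\phi$ at the module functor $p\otimes-\colon\mathcal{P}\to\mathcal{P}$: both composites are naturally isomorphic to the respective identity functors, through unitary natural isomorphisms. -/

import Mathlib

set_option linter.unusedSectionVars false
set_option linter.unusedVariables false

open CategoryTheory Limits
open scoped ComplexConjugate

universe v u

noncomputable section

section

open MonoidalCategory Bicategory
open scoped MonoidalRightAction

/-! ### Unitary categories -/

/-- A unitary (1-)category: a `ℂ`-linear category with an antilinear, involutive and positive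
operation `dag` that reverses morphisms and fixes objects. -/
class UnitaryCategory (C : Type u) [Category.{v} C] [Preadditive C] [Linear ℂ C] where
  dag : ∀ {X Y : C}, (X ⟶ Y) → (Y ⟶ X)
  dag_dag : ∀ {X Y : C} (f : X ⟶ Y), dag (dag f) = f
  dag_id : ∀ X : C, dag (𝟙 X) = 𝟙 X
  dag_comp : ∀ {X Y Z : C} (f : X ⟶ Y) (g : Y ⟶ Z), dag (f ≫ g) = dag g ≫ dag f
  dag_add : ∀ {X Y : C} (f g : X ⟶ Y), dag (f + g) = dag f + dag g
  dag_smul : ∀ {X Y : C} (a : ℂ) (f : X ⟶ Y), dag (a • f) = conj a • dag f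
  dag_pos : ∀ {X Y : C} (f : X ⟶ Y), f ≫ dag f = 0 → f = 0

open UnitaryCategory

attribute [simp] UnitaryCategory.dag_dag UnitaryCategory.dag_id UnitaryCategory.dag_comp
  UnitaryCategory.dag_add UnitaryCategory.dag_smul

/-- A morphism is unitary if its adjoint is its inverse. -/
structure IsUnitary {C : Type u} [Category.{v} C] [Preadditive C] [Linear ℂ C]
    [UnitaryCategory C] {X Y : C} (f : X ⟶ Y) : Prop where
  comp_dag : f ≫ dag f = 𝟙 X
  dag_comp : dag f ≫ f = 𝟙 Y

section

variable {C : Type u} [Category.{v} C] [Preadditive C] [Linear ℂ C] [UnitaryCategory C]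

theorem isUnitary_id (X : C) : IsUnitary (𝟙 X) := ⟨by simp, by simp⟩

theorem IsUnitary.comp {X Y Z : C} {f : X ⟶ Y} {g : Y ⟶ Z} (hf : IsUnitary f)
    (hg : IsUnitary g) : IsUnitary (f ≫ g) := by
  constructor
  · rw [UnitaryCategory.dag_comp, Category.assoc, ← Category.assoc g, hg.comp_dag,
      Category.id_comp, hf.comp_dag]
  · rw [UnitaryCategory.dag_comp, Category.assoc, ← Category.assoc (dag f), hf.dag_comp,
      Category.id_comp, hg.dag_comp]

theorem IsUnitary.dag_eq_inv {X Y : C} {e : X ≅ Y} (h : IsUnitary e.hom) :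
    dag e.hom = e.inv := by
  rw [← cancel_epi e.hom, h.comp_dag, e.hom_inv_id]

theorem isUnitary_of_dag_eq_inv {X Y : C} {e : X ≅ Y} (h : dag e.hom = e.inv) :
    IsUnitary e.hom := ⟨by simp [h], by simp [h]⟩

theorem IsUnitary.symm {X Y : C} {e : X ≅ Y} (h : IsUnitary e.hom) : IsUnitary e.inv := by
  have := h.dag_eq_inv
  exact ⟨by rw [← this]; simp [h.dag_comp], by rw [← this]; simp [h.comp_dag]⟩

end

/-- A functor between unitary categories is unitary if it is `ℂ`-linear and commutes with `dag`. -/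
structure IsUnitaryFunctor {C : Type*} [Category* C] [Preadditive C] [Linear ℂ C]
    [UnitaryCategory C] {D : Type*} [Category* D] [Preadditive D] [Linear ℂ D]
    [UnitaryCategory D] (F : C ⥤ D) : Prop where
  map_add : ∀ {X Y : C} (f g : X ⟶ Y), F.map (f + g) = F.map f + F.map g
  map_smul : ∀ {X Y : C} (a : ℂ) (f : X ⟶ Y), F.map (a • f) = a • F.map f
  map_dag : ∀ {X Y : C} (f : X ⟶ Y), F.map (dag f) = dag (F.map f)

theorem IsUnitaryFunctor.map_isUnitary {C : Type*} [Category* C] [Preadditive C] [Linear ℂ C]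
    [UnitaryCategory C] {D : Type*} [Category* D] [Preadditive D] [Linear ℂ D]
    [UnitaryCategory D] {F : C ⥤ D} (hF : IsUnitaryFunctor F) {X Y : C} {f : X ⟶ Y}
    (hf : IsUnitary f) : IsUnitary (F.map f) :=
  ⟨by rw [← hF.map_dag, ← F.map_comp, hf.comp_dag, F.map_id],
   by rw [← hF.map_dag, ← F.map_comp, hf.dag_comp, F.map_id]⟩

/-- A finite unitary category, i.e. an object of `2Hilb`: a unitary category with finite orthogonal
direct sums, split idempotents and finite-dimensional morphism spaces, which is semisimple with
finitely many isomorphism classes of simple objects. -/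
class FiniteUnitaryCategory (C : Type u) [Category.{v} C] [Preadditive C] [Linear ℂ C]
    [UnitaryCategory C] : Prop extends HasFiniteBiproducts C, IsIdempotentComplete C where
  orthogonal_sum : ∀ X Y : C, ∃ (Z : C) (i : X ⟶ Z) (j : Y ⟶ Z), i ≫ dag i = 𝟙 X ∧
    j ≫ dag j = 𝟙 Y ∧ dag i ≫ i + dag j ≫ j = 𝟙 Z
  finiteDimensional : ∀ X Y : C, FiniteDimensional ℂ (X ⟶ Y)
  semisimple : ∃ (n : ℕ) (S : Fin n → C), (∀ i, Simple (S i)) ∧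
    ∀ X : C, ∃ (m : ℕ) (k : Fin m → Fin n), Nonempty (X ≅ ⨁ fun j => S (k j))

/-! ### Unitary multi-fusion categories and their right modules -/

/-- A unitary multi-fusion category: a finite unitary category with a rigid monoidal structure
whose tensor product is a bilinear functor compatible with `dag` and whose coherence isomorphisms
are unitary. The tensor unit is not required to be simple. -/
class UnitaryMultiFusion (P : Type u) [Category.{v} P] [Preadditive P] [Linear ℂ P]
    [UnitaryCategory P] [MonoidalCategory P] : Prop
    extends FiniteUnitaryCategory P, MonoidalPreadditive P, MonoidalLinear ℂ P where
  dag_whiskerLeft : ∀ (p : P) {q r : P} (f : q ⟶ r), dag (p ◁ f) = p ◁ dag f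
  dag_whiskerRight : ∀ {q r : P} (f : q ⟶ r) (p : P), dag (f ▷ p) = dag f ▷ p
  isUnitary_associator : ∀ p q r : P, IsUnitary (α_ p q r).hom
  isUnitary_leftUnitor : ∀ p : P, IsUnitary (λ_ p).hom
  isUnitary_rightUnitor : ∀ p : P, IsUnitary (ρ_ p).hom
  rigid : ∀ p : P, Nonempty (HasLeftDual p) ∧ Nonempty (HasRightDual p)

/-- A right action of `P` on a unitary category `X` is unitary if it is bilinear and compatible
with `dag` on morphisms and its coherence isomorphisms are unitary. -/
class UnitaryRightAction (P : Type*) [Category* P] [Preadditive P] [Linear ℂ P]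
    [UnitaryCategory P] [MonoidalCategory P] (X : Type*) [Category* X] [Preadditive X]
    [Linear ℂ X] [UnitaryCategory X] [MonoidalRightAction P X] : Prop where
  isUnitaryFunctor_left : ∀ x : X, IsUnitaryFunctor (MonoidalRightAction.actionLeft P x)
  isUnitaryFunctor_right : ∀ p : P, IsUnitaryFunctor (MonoidalRightAction.actionRight X p)
  isUnitary_assoc : ∀ (x : X) (p q : P), IsUnitary (αᵣ x p q).hom
  isUnitary_unit : ∀ x : X, IsUnitary (ρᵣ[P] x).hom

variable (P : Type u) [Category.{v} P] [Preadditive P] [Linear ℂ P] [UnitaryCategory P]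
  [MonoidalCategory P]

/-- A finite unitary right `P`-module category, i.e. a right `P`-module in `2Hilb`. -/
structure RModCat where
  carrier : Type u
  [category : Category.{v} carrier]
  [preadditive : Preadditive carrier]
  [linear : Linear ℂ carrier]
  [unitary : UnitaryCategory carrier]
  [finite : FiniteUnitaryCategory carrier]
  [action : MonoidalRightAction P carrier]
  [unitaryAction : UnitaryRightAction P carrier]

attribute [instance] RModCat.category RModCat.preadditive RModCat.linear RModCat.unitary
  RModCat.finite RModCat.action RModCat.unitaryAction

open Functor.LaxRightLinear Functor.OplaxRightLinear

section

variable {P} {C D : Type*} [Category* C] [Category* D] [MonoidalRightAction P C]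
  [MonoidalRightAction P D]

/-- A lax right `P`-linear functor whose structure morphisms are isomorphisms is right
`P`-linear. -/
@[reducible]
def rightLinearOfIso (F : C ⥤ D) (μ : ∀ (d : C) (p : P), F.obj d ⊙ᵣ p ≅ F.obj (d ⊙ᵣ p))
    (nat_right : ∀ (d : C) {p q : P} (f : p ⟶ q),
      F.obj d ⊴ᵣ f ≫ (μ d q).hom = (μ d p).hom ≫ F.map (d ⊴ᵣ f))
    (nat_left : ∀ {d e : C} (f : d ⟶ e) (p : P),
      F.map f ⊵ᵣ p ≫ (μ e p).hom = (μ d p).hom ≫ F.map (f ⊵ᵣ p))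
    (assoc : ∀ (d : C) (p q : P), (μ d (p ⊗ q)).hom ≫ F.map (αᵣ d p q).hom =
      (αᵣ (F.obj d) p q).hom ≫ (μ d p).hom ⊵ᵣ q ≫ (μ (d ⊙ᵣ p) q).hom)
    (unit : ∀ d : C, (ρᵣ[P] (F.obj d)).hom = (μ d (𝟙_ P)).hom ≫ F.map (ρᵣ d).hom) :
    F.RightLinear P where
  μᵣ d p := (μ d p).hom
  μᵣ_naturality_right := nat_right
  μᵣ_naturality_left := nat_left
  μᵣ_associativity := assoc
  μᵣ_unitality := unit
  δᵣ d p := (μ d p).inv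
  δᵣ_naturality_right d p q f := by
    rw [Iso.comp_inv_eq, Category.assoc, nat_right, Iso.inv_hom_id_assoc]
  δᵣ_naturality_left f p := by
    rw [Iso.comp_inv_eq, Category.assoc, nat_left, Iso.inv_hom_id_assoc]
  δᵣ_associativity d p q := by
    rw [Iso.inv_comp_eq, ← Category.assoc, assoc]
    simp only [Category.assoc, Iso.hom_inv_id_assoc]
    rw [← MonoidalRightAction.comp_actionHomLeft, Iso.hom_inv_id,
      MonoidalRightAction.id_actionHomLeft, Category.comp_id]
  δᵣ_unitality_inv d := by
    have h := congrArg (fun t => (μ d (𝟙_ P)).inv ≫ t) (unit d)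
    simp only [Iso.inv_hom_id_assoc] at h
    rw [← cancel_mono (ρᵣ[P] (F.obj d)).hom, Iso.inv_hom_id, Category.assoc, h, ← F.map_comp,
      Iso.inv_hom_id, F.map_id]
  μᵣ_comp_δᵣ d p := (μ d p).hom_inv_id
  δᵣ_comp_μᵣ d p := (μ d p).inv_hom_id

end

variable {P}

/-- A unitary right `P`-module functor: a unitary functor with a right `P`-linear structure whose
structure isomorphisms `F x ⊙ p ⟶ F (x ⊙ p)` are unitary. -/
structure ModFunctor (X Y : RModCat P) where
  functor : X.carrier ⥤ Y.carrier
  unitary : IsUnitaryFunctor functor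
  [rightLinear : functor.RightLinear P]
  isUnitary_μ : ∀ (x : X.carrier) (p : P), IsUnitary (μᵣ functor x p)

attribute [instance] ModFunctor.rightLinear

/-- A `P`-module natural transformation. -/
@[ext]
structure ModNatTrans {X Y : RModCat P} (F G : ModFunctor X Y) where
  nat : F.functor ⟶ G.functor
  comm : ∀ (x : X.carrier) (p : P),
    μᵣ F.functor x p ≫ nat.app (x ⊙ᵣ p) = nat.app x ⊵ᵣ p ≫ μᵣ G.functor x p

section

variable {X Y Z : RModCat P}

instance : Category (ModFunctor X Y) where
  Hom F G := ModNatTrans F G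
  id F := ⟨𝟙 _, fun x p => by simp⟩
  comp a b := ⟨a.nat ≫ b.nat, fun x p => by
    rw [NatTrans.comp_app, NatTrans.comp_app, ← Category.assoc, a.comm, Category.assoc, b.comm,
      MonoidalRightAction.comp_actionHomLeft, Category.assoc]⟩
  id_comp a := ModNatTrans.ext (Category.id_comp _)
  comp_id a := ModNatTrans.ext (Category.comp_id _)
  assoc a b c := ModNatTrans.ext (Category.assoc _ _ _)

@[ext]
theorem ModNatTrans.hom_ext {F G : ModFunctor X Y} {a b : F ⟶ G}
    (h : ∀ x, a.nat.app x = b.nat.app x) : a = b :=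
  ModNatTrans.ext (NatTrans.ext (funext h))

@[simp]
theorem ModNatTrans.id_app (F : ModFunctor X Y) (x : X.carrier) :
    (𝟙 F : F ⟶ F).nat.app x = 𝟙 _ := rfl

@[simp]
theorem ModNatTrans.comp_app {F G H : ModFunctor X Y} (a : F ⟶ G) (b : G ⟶ H) (x : X.carrier) :
    (a ≫ b).nat.app x = a.nat.app x ≫ b.nat.app x := rfl

theorem ModNatTrans.naturality {F G : ModFunctor X Y} (a : F ⟶ G) {x y : X.carrier} (f : x ⟶ y) :
    F.functor.map f ≫ a.nat.app y = a.nat.app x ≫ G.functor.map f := a.nat.naturality f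

theorem ModNatTrans.comm_assoc {F G : ModFunctor X Y} (a : ModNatTrans F G) (x : X.carrier) (p : P)
    {z : Y.carrier} (h : G.functor.obj (x ⊙ᵣ p) ⟶ z) :
    μᵣ F.functor x p ≫ a.nat.app (x ⊙ᵣ p) ≫ h = a.nat.app x ⊵ᵣ p ≫ μᵣ G.functor x p ≫ h := by
  rw [← Category.assoc, a.comm, Category.assoc]

/-- A module natural isomorphism from its components. -/
def ModFunctor.isoMk {F G : ModFunctor X Y} (e : ∀ x, F.functor.obj x ≅ G.functor.obj x)
    (nat : ∀ {x y : X.carrier} (f : x ⟶ y),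
      F.functor.map f ≫ (e y).hom = (e x).hom ≫ G.functor.map f)
    (comm : ∀ (x : X.carrier) (p : P),
      μᵣ F.functor x p ≫ (e (x ⊙ᵣ p)).hom = (e x).hom ⊵ᵣ p ≫ μᵣ G.functor x p) : F ≅ G where
  hom := ⟨{ app := fun x => (e x).hom, naturality := fun _ _ f => nat f }, comm⟩
  inv := ⟨{ app := fun x => (e x).inv
            naturality := fun x y f => by
              rw [Iso.comp_inv_eq, Category.assoc, nat, Iso.inv_hom_id_assoc] }, fun x p => by
      dsimp only
      rw [Iso.comp_inv_eq, Category.assoc, comm, ← Category.assoc,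
        ← MonoidalRightAction.comp_actionHomLeft, Iso.inv_hom_id,
        MonoidalRightAction.id_actionHomLeft, Category.id_comp]⟩
  hom_inv_id := by ext x; exact (e x).hom_inv_id
  inv_hom_id := by ext x; exact (e x).inv_hom_id

@[simp]
theorem ModFunctor.isoMk_hom_app {F G : ModFunctor X Y}
    (e : ∀ x, F.functor.obj x ≅ G.functor.obj x) (nat) (comm) (x : X.carrier) :
    (ModFunctor.isoMk (F := F) (G := G) e nat comm).hom.nat.app x = (e x).hom := rfl

@[simp]
theorem ModFunctor.isoMk_inv_app {F G : ModFunctor X Y}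
    (e : ∀ x, F.functor.obj x ≅ G.functor.obj x) (nat) (comm) (x : X.carrier) :
    (ModFunctor.isoMk (F := F) (G := G) e nat comm).inv.nat.app x = (e x).inv := rfl

theorem IsUnitaryFunctor.id {C : Type*} [Category* C] [Preadditive C] [Linear ℂ C]
    [UnitaryCategory C] : IsUnitaryFunctor (𝟭 C) := ⟨fun _ _ => rfl, fun _ _ => rfl, fun _ => rfl⟩

theorem IsUnitaryFunctor.comp {C D E : Type*} [Category* C] [Preadditive C] [Linear ℂ C]
    [UnitaryCategory C] [Category* D] [Preadditive D] [Linear ℂ D] [UnitaryCategory D]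
    [Category* E] [Preadditive E] [Linear ℂ E] [UnitaryCategory E] {F : C ⥤ D} {G : D ⥤ E}
    (hF : IsUnitaryFunctor F) (hG : IsUnitaryFunctor G) : IsUnitaryFunctor (F ⋙ G) :=
  ⟨fun f g => by simp [hF.map_add, hG.map_add], fun a f => by simp [hF.map_smul, hG.map_smul],
   fun f => by simp [hF.map_dag, hG.map_dag]⟩

theorem IsUnitary.actionHomLeft {x y : X.carrier} {f : x ⟶ y} (hf : IsUnitary f) (p : P) :
    IsUnitary (f ⊵ᵣ p) :=
  (UnitaryRightAction.isUnitaryFunctor_right (X := X.carrier) p).map_isUnitary hf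

theorem IsUnitary.actionHomRight (x : X.carrier) {p q : P} {f : p ⟶ q} (hf : IsUnitary f) :
    IsUnitary (x ⊴ᵣ f) :=
  (UnitaryRightAction.isUnitaryFunctor_left (P := P) x).map_isUnitary hf

variable (X) in
/-- The identity module functor. -/
def ModFunctor.id : ModFunctor X X where
  functor := 𝟭 _
  unitary := .id
  rightLinear := rightLinearOfIso (𝟭 _) (fun _ _ => Iso.refl _) (fun d p q f => by simp)
    (fun f p => by simp) (fun d p q => by simp) (fun d => by simp)
  isUnitary_μ x p := isUnitary_id _

/-- The composition of module functors. -/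
def ModFunctor.comp (F : ModFunctor X Y) (G : ModFunctor Y Z) : ModFunctor X Z where
  functor := F.functor ⋙ G.functor
  unitary := F.unitary.comp G.unitary
  rightLinear := rightLinearOfIso (F.functor ⋙ G.functor)
    (fun x p => Functor.RightLinear.μᵣIso G.functor (F.functor.obj x) p ≪≫
      G.functor.mapIso (Functor.RightLinear.μᵣIso F.functor x p))
    (fun d p q f => by simp [← Functor.map_comp])
    (fun f p => by simp [← Functor.map_comp])
    (fun d p q => by
      simp only [Functor.comp_obj, Functor.comp_map, Iso.trans_hom, Functor.mapIso_hom,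
        Category.assoc, ← Functor.map_comp, μᵣ_associativity]
      rw [G.functor.map_comp, μᵣ_associativity_assoc]
      simp)
    (fun d => by simp [← Functor.map_comp])
  isUnitary_μ x p := (G.isUnitary_μ _ _).comp (G.unitary.map_isUnitary (F.isUnitary_μ _ _))

end

section

variable {W X Y Z : RModCat P}

@[simp]
theorem ModFunctor.id_μ (x : X.carrier) (p : P) :
    μᵣ (ModFunctor.id X).functor x p = 𝟙 (x ⊙ᵣ p) := rfl

@[simp]
theorem ModFunctor.comp_μ (F : ModFunctor X Y) (G : ModFunctor Y Z) (x : X.carrier) (p : P) :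
    μᵣ (F.comp G).functor x p =
      μᵣ G.functor (F.functor.obj x) p ≫ G.functor.map (μᵣ F.functor x p) := rfl

@[simp]
theorem ModFunctor.id_obj (x : X.carrier) : (ModFunctor.id X).functor.obj x = x := rfl

@[simp]
theorem ModFunctor.id_map {x y : X.carrier} (f : x ⟶ y) : (ModFunctor.id X).functor.map f = f := rfl

@[simp]
theorem ModFunctor.comp_obj (F : ModFunctor X Y) (G : ModFunctor Y Z) (x : X.carrier) :
    (F.comp G).functor.obj x = G.functor.obj (F.functor.obj x) := rfl

@[simp]
theorem ModFunctor.comp_map (F : ModFunctor X Y) (G : ModFunctor Y Z) {x y : X.carrier}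
    (f : x ⟶ y) : (F.comp G).functor.map f = G.functor.map (F.functor.map f) := rfl

/-- Left whiskering of module natural transformations. -/
def ModFunctor.whiskerLeft (F : ModFunctor X Y) {G H : ModFunctor Y Z} (a : G ⟶ H) :
    F.comp G ⟶ F.comp H :=
  ⟨Functor.whiskerLeft F.functor a.nat, fun x p => by
    dsimp only [ModFunctor.comp_μ, Functor.whiskerLeft_app]
    simp only [ModFunctor.comp, Functor.comp_obj, Category.assoc, ModNatTrans.naturality]
    exact a.comm_assoc _ _ _⟩

/-- Right whiskering of module natural transformations. -/
def ModFunctor.whiskerRight {F G : ModFunctor X Y} (a : F ⟶ G) (H : ModFunctor Y Z) :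
    F.comp H ⟶ G.comp H :=
  ⟨Functor.whiskerRight a.nat H.functor, fun x p => by
    dsimp only [ModFunctor.comp_μ, Functor.whiskerRight_app]
    simp only [ModFunctor.comp, Functor.comp_obj, Category.assoc, μᵣ_naturality_left_assoc,
      ← Functor.map_comp]
    rw [a.comm]⟩

/-- The 2-category `ΣP` of finite unitary right `P`-modules, unitary module functors and module
natural transformations. -/
instance : Bicategory (RModCat P) where
  Hom X Y := ModFunctor X Y
  id X := ModFunctor.id X
  comp F G := F.comp G
  homCategory _ _ := inferInstance
  whiskerLeft F _ _ a := F.whiskerLeft a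
  whiskerRight a H := ModFunctor.whiskerRight a H
  associator F G H := ModFunctor.isoMk (fun x => Iso.refl _) (fun f => by simp)
    (fun x p => by simp)
  leftUnitor F := ModFunctor.isoMk (fun x => Iso.refl _) (fun f => by simp) (fun x p => by simp)
  rightUnitor F := ModFunctor.isoMk (fun x => Iso.refl _) (fun f => by simp) (fun x p => by simp)
  whiskerLeft_id F G := by ext x; rfl
  whiskerLeft_comp F G H I a b := by ext x; rfl
  id_whiskerLeft {X Y F G} a := by
    ext x
    change a.nat.app x = 𝟙 (F.functor.obj x) ≫ a.nat.app x ≫ 𝟙 (G.functor.obj x)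
    simp
  comp_whiskerLeft {X Y Z W} F G {H I} a := by
    ext x
    change a.nat.app (G.functor.obj (F.functor.obj x)) = 𝟙 _ ≫ a.nat.app _ ≫ 𝟙 _
    simp
  id_whiskerRight F G := by ext x; exact G.functor.map_id _
  comp_whiskerRight a b F := by ext x; exact F.functor.map_comp _ _
  whiskerRight_id {X Y F G} a := by
    ext x
    change a.nat.app x = 𝟙 (F.functor.obj x) ≫ a.nat.app x ≫ 𝟙 (G.functor.obj x)
    simp
  whiskerRight_comp {X Y Z W F G} a H I := by
    ext x
    change I.functor.map (H.functor.map (a.nat.app x)) =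
      𝟙 _ ≫ I.functor.map (H.functor.map (a.nat.app x)) ≫ 𝟙 _
    simp
  whisker_assoc {X Y Z W} F {G H} a I := by
    ext x
    change I.functor.map (a.nat.app (F.functor.obj x)) = 𝟙 _ ≫ I.functor.map _ ≫ 𝟙 _
    simp
  whisker_exchange a b := by ext x; exact (b.nat.naturality _).symm
  pentagon F G H I := by
    ext x
    change I.functor.map (𝟙 _) ≫ 𝟙 _ ≫ 𝟙 _ = 𝟙 _ ≫ 𝟙 _
    simp
  triangle F G := by
    ext x
    change 𝟙 _ ≫ 𝟙 _ = G.functor.map (𝟙 _)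
    simp

end

/-! ### Unitary 2-categories -/

/-- A unitary 2-category: its categories of 1-morphisms are unitary categories, horizontal
composition is bilinear and compatible with `dag`, and its coherence isomorphisms are unitary. -/
class UnitaryBicategory (B : Type*) [Bicategory B] where
  preadditive : ∀ a b : B, Preadditive (a ⟶ b)
  linear : ∀ a b : B, Linear ℂ (a ⟶ b)
  unitary : ∀ a b : B, UnitaryCategory (a ⟶ b)
  isUnitaryFunctor_left : ∀ {a b : B} (f : a ⟶ b) (c : B),
    IsUnitaryFunctor (Bicategory.precomp c f)
  isUnitaryFunctor_right : ∀ (a : B) {b c : B} (g : b ⟶ c),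
    IsUnitaryFunctor (Bicategory.postcomp a g)
  isUnitary_associator : ∀ {a b c d : B} (f : a ⟶ b) (g : b ⟶ c) (h : c ⟶ d),
    IsUnitary (Bicategory.associator f g h).hom
  isUnitary_leftUnitor : ∀ {a b : B} (f : a ⟶ b), IsUnitary (Bicategory.leftUnitor f).hom
  isUnitary_rightUnitor : ∀ {a b : B} (f : a ⟶ b), IsUnitary (Bicategory.rightUnitor f).hom

attribute [reducible, instance] UnitaryBicategory.preadditive UnitaryBicategory.linear
  UnitaryBicategory.unitary

section

variable {X Y : RModCat P}

namespace ModNatTrans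

variable {F G : ModFunctor X Y}

theorem action_add {x y : X.carrier} (f g : x ⟶ y) (p : P) :
    (f + g) ⊵ᵣ p = f ⊵ᵣ p + g ⊵ᵣ p :=
  (UnitaryRightAction.isUnitaryFunctor_right (X := X.carrier) p).map_add f g

theorem action_smul {x y : X.carrier} (a : ℂ) (f : x ⟶ y) (p : P) :
    (a • f) ⊵ᵣ p = a • f ⊵ᵣ p :=
  (UnitaryRightAction.isUnitaryFunctor_right (X := X.carrier) p).map_smul a f

theorem action_dag {x y : X.carrier} (f : x ⟶ y) (p : P) :
    (dag f) ⊵ᵣ p = dag (f ⊵ᵣ p) :=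
  (UnitaryRightAction.isUnitaryFunctor_right (X := X.carrier) p).map_dag f

theorem action_zero {x y : X.carrier} (p : P) : (0 : x ⟶ y) ⊵ᵣ p = 0 := by
  simpa using action_smul (0 : ℂ) (0 : x ⟶ y) p

instance : Zero (F ⟶ G) where
  zero := ⟨0, fun x p => by simp [action_zero]⟩

instance : Add (F ⟶ G) where
  add a b := ⟨a.nat + b.nat, fun x p => by simp [action_add, a.comm, b.comm]⟩

instance : SMul ℂ (F ⟶ G) where
  smul c a := ⟨c • a.nat, fun x p => by simp [action_smul, a.comm]⟩

instance : Neg (F ⟶ G) where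
  neg a := ⟨(-1 : ℂ) • a.nat, fun x p => by simp only [NatTrans.app_smul, action_smul]; simp [a.comm]⟩

@[simp] theorem add_app (a b : F ⟶ G) (x : X.carrier) :
    (a + b).nat.app x = a.nat.app x + b.nat.app x := rfl

@[simp] theorem zero_app (x : X.carrier) : (0 : F ⟶ G).nat.app x = 0 := rfl

@[simp] theorem smul_app (c : ℂ) (a : F ⟶ G) (x : X.carrier) :
    (c • a).nat.app x = c • a.nat.app x := rfl

@[simp] theorem neg_app (a : F ⟶ G) (x : X.carrier) : (-a).nat.app x = -a.nat.app x := by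
  change (-1 : ℂ) • a.nat.app x = _
  simp

instance : AddCommGroup (F ⟶ G) where
  add_assoc a b c := by ext x; simp [add_assoc]
  zero_add a := by ext x; simp
  add_zero a := by ext x; simp
  neg_add_cancel a := by ext x; simp
  add_comm a b := by ext x; simp [add_comm]
  nsmul := nsmulRec
  zsmul := zsmulRec

instance : Preadditive (ModFunctor X Y) where
  add_comp _ _ _ a b c := by ext x; simp
  comp_add _ _ _ a b c := by ext x; simp

instance : Module ℂ (F ⟶ G) where
  one_smul a := by ext x; simp
  mul_smul c d a := by ext x; simp [mul_smul]
  smul_zero c := by ext x; simp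
  smul_add c a b := by ext x; simp
  add_smul c d a := by ext x; simp [add_smul]
  zero_smul a := by ext x; simp

instance : Linear ℂ (ModFunctor X Y) where
  smul_comp _ _ _ c a b := by ext x; simp
  comp_smul _ _ _ a c b := by ext x; simp

/-- The adjoint of a module natural transformation is taken componentwise. -/
instance : UnitaryCategory (ModFunctor X Y) where
  dag {F G} a :=
    ⟨{ app := fun x => dag (a.nat.app x)
       naturality := fun x y f => by
         have h := congrArg dag (a.naturality (dag f))
         simp only [UnitaryCategory.dag_comp, ← F.unitary.map_dag, ← G.unitary.map_dag,
           dag_dag] at h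
         exact h.symm }, fun x p => by
       have h := congrArg dag (a.comm x p)
       simp only [UnitaryCategory.dag_comp, ← action_dag] at h
       have hF : μᵣ F.functor x p ≫ dag (μᵣ F.functor x p) = 𝟙 _ := (F.isUnitary_μ x p).comp_dag
       have hG : dag (μᵣ G.functor x p) ≫ μᵣ G.functor x p = 𝟙 _ := (G.isUnitary_μ x p).dag_comp
       have hF' : dag (μᵣ F.functor x p) ≫ μᵣ F.functor x p = 𝟙 _ := (F.isUnitary_μ x p).dag_comp
       have hG' : μᵣ G.functor x p ≫ dag (μᵣ G.functor x p) = 𝟙 _ := (G.isUnitary_μ x p).comp_dag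
       calc
         μᵣ G.functor x p ≫ dag (a.nat.app (x ⊙ᵣ p)) = μᵣ G.functor x p ≫ (dag (a.nat.app (x ⊙ᵣ p)) ≫ dag (μᵣ F.functor x p)) ≫
              μᵣ F.functor x p := by
            rw [Category.assoc, hF', Category.comp_id]
         _ = _ := by
            rw [h, Category.assoc, ← Category.assoc, hG', Category.id_comp]⟩
  dag_dag a := by ext x; exact dag_dag _
  dag_id F := by ext x; exact UnitaryCategory.dag_id _
  dag_comp a b := by ext x; exact UnitaryCategory.dag_comp _ _
  dag_add a b := by ext x; exact UnitaryCategory.dag_add _ _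
  dag_smul c a := by ext x; exact UnitaryCategory.dag_smul _ _
  dag_pos a h := by
    ext x
    exact dag_pos _ (congrArg (fun t => t.nat.app x) h)

@[simp] theorem dag_app (a : F ⟶ G) (x : X.carrier) :
    (dag a).nat.app x = dag (a.nat.app x) := rfl

end ModNatTrans

theorem ModFunctor.isUnitary_of_app {F G : ModFunctor X Y} {a : F ⟶ G}
    (h : ∀ x, IsUnitary (a.nat.app x)) : IsUnitary a :=
  ⟨by ext x; exact (h x).comp_dag, by ext x; exact (h x).dag_comp⟩

end

section

local instance (X Y : RModCat P) : Preadditive (X ⟶ Y) :=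
  inferInstanceAs (Preadditive (ModFunctor X Y))

local instance (X Y : RModCat P) : Linear ℂ (X ⟶ Y) :=
  inferInstanceAs (Linear ℂ (ModFunctor X Y))

local instance (X Y : RModCat P) : UnitaryCategory (X ⟶ Y) :=
  inferInstanceAs (UnitaryCategory (ModFunctor X Y))

/-- `ΣP` is a unitary 2-category. -/
instance : UnitaryBicategory (RModCat P) where
  preadditive _ _ := inferInstance
  linear _ _ := inferInstance
  unitary _ _ := inferInstance
  isUnitaryFunctor_left _ _ :=
    ⟨fun _ _ => ModNatTrans.hom_ext fun _ => rfl, fun _ _ => ModNatTrans.hom_ext fun _ => rfl,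
     fun _ => ModNatTrans.hom_ext fun _ => rfl⟩
  isUnitaryFunctor_right _ _ _ G :=
    ⟨fun _ _ => ModNatTrans.hom_ext fun _ => G.unitary.map_add _ _,
     fun _ _ => ModNatTrans.hom_ext fun _ => G.unitary.map_smul _ _,
     fun _ => ModNatTrans.hom_ext fun _ => G.unitary.map_dag _⟩
  isUnitary_associator _ _ _ := ModFunctor.isUnitary_of_app fun _ => isUnitary_id _
  isUnitary_leftUnitor _ := ModFunctor.isUnitary_of_app fun _ => isUnitary_id _
  isUnitary_rightUnitor _ := ModFunctor.isUnitary_of_app fun _ => isUnitary_id _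

end

end

open UnitaryCategory

section

open scoped Bicategory
open scoped Pseudofunctor.StrongTrans
open MonoidalCategoryStruct (tensorObj)

local infixr:70 " ⊗ " => MonoidalCategoryStruct.tensorObj

/-! ### The 2-category of unitary 2-functors -/

open scoped Pseudofunctor.StrongTrans

section

variable {S : Type*} [Bicategory S] [UnitaryBicategory S]

theorem IsUnitary.whiskerLeft {a b c : S} (f : a ⟶ b) {g h : b ⟶ c} {t : g ⟶ h}
    (ht : IsUnitary t) : IsUnitary (f ◁ t) :=
  (UnitaryBicategory.isUnitaryFunctor_left f c).map_isUnitary ht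

theorem IsUnitary.whiskerRight {a b c : S} {f g : a ⟶ b} {t : f ⟶ g}
    (ht : IsUnitary t) (h : b ⟶ c) : IsUnitary (t ▷ h) :=
  (UnitaryBicategory.isUnitaryFunctor_right a h).map_isUnitary ht

end

/-- A unitary 2-functor: a pseudofunctor that is `ℂ`-linear and commutes with `dag` on 2-morphisms
and whose coherence isomorphisms are unitary. -/
structure UnitaryPseudofunctor (S T : Type*) [Bicategory S] [UnitaryBicategory S] [Bicategory T]
    [UnitaryBicategory T] where
  pseudo : S ⥤ᵖ T
  isUnitaryFunctor : ∀ a b : S, IsUnitaryFunctor (pseudo.mapFunctor a b)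
  isUnitary_mapId : ∀ a : S, IsUnitary (pseudo.mapId a).hom
  isUnitary_mapComp : ∀ {a b c : S} (f : a ⟶ b) (g : b ⟶ c), IsUnitary (pseudo.mapComp f g).hom

/-- A pseudonatural transformation is unitary if its naturality 2-isomorphisms are unitary. -/
def unitaryTrans {S T : Type*} [Bicategory S] [Bicategory T] [UnitaryBicategory T]
    (F G : S ⥤ᵖ T) : ObjectProperty (F ⟶ G) :=
  fun η => ∀ {a b : S} (f : a ⟶ b), IsUnitary (η.naturality f).hom

section

variable {S T : Type*} [Bicategory S] [Bicategory T] [UnitaryBicategory T]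

theorem unitaryTrans_id (F : S ⥤ᵖ T) : unitaryTrans F F (𝟙 F) := fun f => by
  rw [Pseudofunctor.StrongTrans.categoryStruct_id_naturality_hom]
  exact (UnitaryBicategory.isUnitary_rightUnitor _).comp
    (UnitaryBicategory.isUnitary_leftUnitor _).symm

theorem unitaryTrans_comp {F G H : S ⥤ᵖ T} {η : F ⟶ G} {θ : G ⟶ H} (hη : unitaryTrans F G η)
    (hθ : unitaryTrans G H θ) : unitaryTrans F H (η ≫ θ) := fun f => by
  rw [Pseudofunctor.StrongTrans.categoryStruct_comp_naturality_hom]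
  exact (UnitaryBicategory.isUnitary_associator _ _ _).symm.comp
    (((hη f).whiskerRight _).comp ((UnitaryBicategory.isUnitary_associator _ _ _).comp
      (((hθ f).whiskerLeft _).comp (UnitaryBicategory.isUnitary_associator _ _ _).symm)))

variable [UnitaryBicategory S]

/-- The 2-category `Fun(S, T)` of unitary 2-functors, unitary pseudonatural transformations and
modifications. -/
instance : Bicategory (UnitaryPseudofunctor S T) where
  Hom F G := (unitaryTrans F.pseudo G.pseudo).FullSubcategory
  id F := ⟨𝟙 F.pseudo, unitaryTrans_id _⟩
  comp η θ := ⟨η.obj ≫ θ.obj, unitaryTrans_comp η.property θ.property⟩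
  homCategory _ _ := inferInstance
  whiskerLeft η _ _ Γ := ObjectProperty.homMk (η.obj ◁ Γ.hom)
  whiskerRight Γ η := ObjectProperty.homMk (Γ.hom ▷ η.obj)
  associator η θ ι := ObjectProperty.isoMk _ (Bicategory.associator η.obj θ.obj ι.obj)
  leftUnitor η := ObjectProperty.isoMk _ (Bicategory.leftUnitor η.obj)
  rightUnitor η := ObjectProperty.isoMk _ (Bicategory.rightUnitor η.obj)
  whiskerLeft_id η θ := ObjectProperty.hom_ext _ (Bicategory.whiskerLeft_id _ _)
  whiskerLeft_comp η _ _ _ Γ Λ := ObjectProperty.hom_ext _ (Bicategory.whiskerLeft_comp _ _ _)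
  id_whiskerLeft Γ := ObjectProperty.hom_ext _ (Bicategory.id_whiskerLeft _)
  comp_whiskerLeft η θ _ _ Γ := ObjectProperty.hom_ext _ (Bicategory.comp_whiskerLeft _ _ _)
  id_whiskerRight η θ := ObjectProperty.hom_ext _ (Bicategory.id_whiskerRight _ _)
  comp_whiskerRight Γ Λ η := ObjectProperty.hom_ext _ (Bicategory.comp_whiskerRight _ _ _)
  whiskerRight_id Γ := ObjectProperty.hom_ext _ (Bicategory.whiskerRight_id _)
  whiskerRight_comp Γ η θ := ObjectProperty.hom_ext _ (Bicategory.whiskerRight_comp _ _ _)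
  whisker_assoc η _ _ Γ θ := ObjectProperty.hom_ext _ (Bicategory.whisker_assoc _ _ _)
  whisker_exchange Γ Λ := ObjectProperty.hom_ext _ (Bicategory.whisker_exchange _ _)
  pentagon η θ ι κ := ObjectProperty.hom_ext _ (Bicategory.pentagon _ _ _ _)
  triangle η θ := ObjectProperty.hom_ext _ (Bicategory.triangle _ _)

end

section

variable {S T : Type*} [Bicategory S] [Bicategory T] [UnitaryBicategory T]

theorem UnitaryBicategory.whiskerLeft_add {a b c : T} (f : a ⟶ b) {g h : b ⟶ c} (s t : g ⟶ h) :
    f ◁ (s + t) = f ◁ s + f ◁ t := (isUnitaryFunctor_left f c).map_add s t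

theorem UnitaryBicategory.whiskerLeft_smul {a b c : T} (f : a ⟶ b) {g h : b ⟶ c} (r : ℂ)
    (s : g ⟶ h) : f ◁ (r • s) = r • f ◁ s := (isUnitaryFunctor_left f c).map_smul r s

theorem UnitaryBicategory.whiskerLeft_dag {a b c : T} (f : a ⟶ b) {g h : b ⟶ c}
    (s : g ⟶ h) : f ◁ dag s = dag (f ◁ s) := (isUnitaryFunctor_left f c).map_dag s

theorem UnitaryBicategory.whiskerRight_add {a b c : T} {f g : a ⟶ b} (s t : f ⟶ g) (h : b ⟶ c) :
    (s + t) ▷ h = s ▷ h + t ▷ h := (isUnitaryFunctor_right a h).map_add s t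

theorem UnitaryBicategory.whiskerRight_smul {a b c : T} {f g : a ⟶ b} (r : ℂ) (s : f ⟶ g)
    (h : b ⟶ c) : (r • s) ▷ h = r • s ▷ h := (isUnitaryFunctor_right a h).map_smul r s

theorem UnitaryBicategory.whiskerRight_dag {a b c : T} {f g : a ⟶ b} (s : f ⟶ g)
    (h : b ⟶ c) : dag s ▷ h = dag (s ▷ h) := (isUnitaryFunctor_right a h).map_dag s

namespace Modification

open UnitaryBicategory

variable {F G : S ⥤ᵖ T} {η θ : F ⟶ G}

instance : SMul ℂ (η ⟶ θ) where
  smul r Γ := ⟨{ app := fun a => r • Γ.as.app a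
                 naturality := fun f => by
                   rw [whiskerLeft_smul, whiskerRight_smul, Linear.smul_comp, Linear.comp_smul,
                     Γ.as.naturality] }⟩

instance : Add (η ⟶ θ) where
  add Γ Λ := ⟨{ app := fun a => Γ.as.app a + Λ.as.app a
                naturality := fun f => by
                  rw [whiskerLeft_add, whiskerRight_add, Preadditive.add_comp,
                    Preadditive.comp_add, Γ.as.naturality, Λ.as.naturality] }⟩

instance : Zero (η ⟶ θ) where
  zero := ⟨{ app := fun a => 0
             naturality := fun {a b} f => by
               have h := whiskerLeft_smul (F.map f) (0 : ℂ) (0 : η.app b ⟶ θ.app b)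
               have h' := whiskerRight_smul (0 : ℂ) (0 : η.app a ⟶ θ.app a) (G.map f)
               rw [zero_smul, zero_smul] at h h'
               rw [h, h', Limits.zero_comp, Limits.comp_zero] }⟩

instance : Neg (η ⟶ θ) where
  neg Γ := (-1 : ℂ) • Γ

@[simp] theorem add_app (Γ Λ : η ⟶ θ) (a : S) :
    (Γ + Λ).as.app a = Γ.as.app a + Λ.as.app a := rfl

@[simp] theorem zero_app (a : S) : (0 : η ⟶ θ).as.app a = 0 := rfl

@[simp] theorem smul_app (r : ℂ) (Γ : η ⟶ θ) (a : S) : (r • Γ).as.app a = r • Γ.as.app a := rfl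

@[simp] theorem neg_app (Γ : η ⟶ θ) (a : S) : (-Γ).as.app a = -Γ.as.app a := by
  change (-1 : ℂ) • Γ.as.app a = _
  rw [neg_smul, one_smul]

instance : AddCommGroup (η ⟶ θ) where
  add_assoc a b c := by ext x; simp [add_assoc]
  zero_add a := by ext x; simp
  add_zero a := by ext x; simp
  neg_add_cancel a := by ext x; simp
  add_comm a b := by ext x; simp [add_comm]
  nsmul := nsmulRec
  zsmul := zsmulRec

instance : Preadditive (F ⟶ G) where
  add_comp _ _ _ a b c := by ext x; exact Preadditive.add_comp _ _ _ _ _ _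
  comp_add _ _ _ a b c := by ext x; exact Preadditive.comp_add _ _ _ _ _ _

instance : Module ℂ (η ⟶ θ) where
  one_smul a := by ext x; simp
  mul_smul c d a := by ext x; simp [mul_smul]
  smul_zero c := by ext x; simp
  smul_add c a b := by ext x; simp
  add_smul c d a := by ext x; simp [add_smul]
  zero_smul a := by ext x; simp

instance : Linear ℂ (F ⟶ G) where
  smul_comp _ _ _ c a b := by ext x; exact Linear.smul_comp _ _ _ _ _ _
  comp_smul _ _ _ a c b := by ext x; exact Linear.comp_smul _ _ _ _ _ _

end Modification

open UnitaryBicategory in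
/-- The adjoint of a modification is taken componentwise. -/
instance (F G : S ⥤ᵖ T) : UnitaryCategory (unitaryTrans F G).FullSubcategory where
  dag {η θ} Γ := ObjectProperty.homMk
    ⟨{ app := fun a => dag (Γ.hom.as.app a)
       naturality := fun {a b} f => by
         have h := congrArg dag (Γ.hom.as.naturality f)
         rw [UnitaryCategory.dag_comp, UnitaryCategory.dag_comp, ← whiskerLeft_dag,
           ← whiskerRight_dag] at h
         have hη := η.property f
         have hθ := θ.property f
         calc
           F.map f ◁ dag (Γ.hom.as.app b) ≫ (η.obj.naturality f).hom =
               (θ.obj.naturality f).hom ≫ (dag (θ.obj.naturality f).hom ≫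
                 F.map f ◁ dag (Γ.hom.as.app b)) ≫ (η.obj.naturality f).hom := by
             rw [← Category.assoc, ← Category.assoc, hθ.comp_dag, Category.id_comp]
           _ = _ := by rw [h, Category.assoc, hη.dag_comp, Category.comp_id] }⟩
  dag_dag Γ := by ext a; exact dag_dag _
  dag_id η := by ext a; exact UnitaryCategory.dag_id _
  dag_comp Γ Λ := by ext a; exact UnitaryCategory.dag_comp _ _
  dag_add Γ Λ := by ext a; exact UnitaryCategory.dag_add _ _
  dag_smul r Γ := by ext a; exact UnitaryCategory.dag_smul _ _
  dag_pos Γ h := by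
    ext a
    exact dag_pos _ (congrArg (fun t => t.hom.as.app a) h)

end

/-! ### `E₀`-centers and their loopings -/

section

variable (S : Type*) [Bicategory S] [UnitaryBicategory S]

/-- The `E₀`-center `Z₀(S) = Fun(S, S)` of a unitary 2-category. -/
abbrev ZCenter0 := UnitaryPseudofunctor S S

/-- The identity 2-functor, i.e. the tensor unit of `Z₀(S)`. -/
def ZCenter0.one : ZCenter0 S where
  pseudo := Pseudofunctor.id S
  isUnitaryFunctor _ _ := ⟨fun _ _ => rfl, fun _ _ => rfl, fun _ => rfl⟩
  isUnitary_mapId _ := isUnitary_id _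
  isUnitary_mapComp _ _ := isUnitary_id _

/-- The looping `Ω(Z₀(S))`: the endomorphisms of the tensor unit of `Z₀(S)`, whose tensor
product is the composition of 1-morphisms in `Z₀(S)`. -/
abbrev LoopZCenter0 := EndMonoidal (ZCenter0.one S)

variable {S}

namespace LoopZCenter0

/-- The component at `a` of an object of `Ω(Z₀(S))`. -/
def app (φ : LoopZCenter0 S) (a : S) : a ⟶ a := φ.obj.app a

/-- The naturality 2-isomorphism of an object of `Ω(Z₀(S))`. -/
def nat (φ : LoopZCenter0 S) {a b : S} (f : a ⟶ b) : f ≫ φ.app b ≅ φ.app a ≫ f :=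
  φ.obj.naturality f

/-- The component at `a` of a morphism of `Ω(Z₀(S))`. -/
def homApp {φ ψ : LoopZCenter0 S} (Γ : φ ⟶ ψ) (a : S) : φ.app a ⟶ ψ.app a := Γ.hom.as.app a

theorem isUnitary_nat (φ : LoopZCenter0 S) {a b : S} (f : a ⟶ b) : IsUnitary (φ.nat f).hom :=
  φ.property f

theorem nat_naturality (φ : LoopZCenter0 S) {a b : S} {f g : a ⟶ b} (t : f ⟶ g) :
    t ▷ φ.app b ≫ (φ.nat g).hom = (φ.nat f).hom ≫ φ.app a ◁ t :=
  φ.obj.naturality_naturality t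

theorem nat_id (φ : LoopZCenter0 S) (a : S) :
    (φ.nat (𝟙 a)).hom = (Bicategory.leftUnitor (φ.app a)).hom ≫
      (Bicategory.rightUnitor (φ.app a)).inv := by
  have h := φ.obj.naturality_id a
  change (φ.nat (𝟙 a)).hom ≫ φ.app a ◁ 𝟙 (𝟙 a) = 𝟙 (𝟙 a) ▷ φ.app a ≫
    (Bicategory.leftUnitor (φ.app a)).hom ≫ (Bicategory.rightUnitor (φ.app a)).inv at h
  simpa using h

theorem nat_comp (φ : LoopZCenter0 S) {a b c : S} (f : a ⟶ b) (g : b ⟶ c) :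
    (φ.nat (f ≫ g)).hom = (Bicategory.associator f g (φ.app c)).hom ≫ f ◁ (φ.nat g).hom ≫
      (Bicategory.associator f (φ.app b) g).inv ≫ (φ.nat f).hom ▷ g ≫
      (Bicategory.associator (φ.app a) f g).hom := by
  have h := φ.obj.naturality_comp f g
  change (φ.nat (f ≫ g)).hom ≫ φ.app a ◁ 𝟙 (f ≫ g) = 𝟙 (f ≫ g) ▷ φ.app c ≫
      (Bicategory.associator f g (φ.app c)).hom ≫ f ◁ (φ.nat g).hom ≫
      (Bicategory.associator f (φ.app b) g).inv ≫ (φ.nat f).hom ▷ g ≫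
      (Bicategory.associator (φ.app a) f g).hom at h
  simpa using h

theorem homApp_naturality {φ ψ : LoopZCenter0 S} (Γ : φ ⟶ ψ) {a b : S} (f : a ⟶ b) :
    f ◁ homApp Γ b ≫ (ψ.nat f).hom = (φ.nat f).hom ≫ homApp Γ a ▷ f :=
  Γ.hom.as.naturality f

@[ext]
theorem hom_ext {φ ψ : LoopZCenter0 S} {Γ Λ : φ ⟶ ψ} (h : ∀ a, homApp Γ a = homApp Λ a) :
    Γ = Λ :=
  ObjectProperty.hom_ext _ (Pseudofunctor.StrongTrans.homCategory.ext h)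

/-- An object of `Ω(Z₀(S))` from its components. -/
def mk (app : ∀ a : S, a ⟶ a) (nat : ∀ {a b : S} (f : a ⟶ b), f ≫ app b ≅ app a ≫ f)
    (nat_naturality : ∀ {a b : S} {f g : a ⟶ b} (t : f ⟶ g),
      t ▷ app b ≫ (nat g).hom = (nat f).hom ≫ app a ◁ t)
    (nat_id : ∀ a : S, (nat (𝟙 a)).hom = (Bicategory.leftUnitor (app a)).hom ≫
      (Bicategory.rightUnitor (app a)).inv)
    (nat_comp : ∀ {a b c : S} (f : a ⟶ b) (g : b ⟶ c), (nat (f ≫ g)).hom =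
      (Bicategory.associator f g (app c)).hom ≫ f ◁ (nat g).hom ≫
        (Bicategory.associator f (app b) g).inv ≫ (nat f).hom ▷ g ≫
        (Bicategory.associator (app a) f g).hom)
    (isUnitary_nat : ∀ {a b : S} (f : a ⟶ b), IsUnitary (nat f).hom) : LoopZCenter0 S :=
  ⟨{ app := app
     naturality := nat
     naturality_naturality := nat_naturality
     naturality_id := fun a => by
       change (nat (𝟙 a)).hom ≫ app a ◁ 𝟙 (𝟙 a) = 𝟙 (𝟙 a) ▷ app a ≫
         (Bicategory.leftUnitor (app a)).hom ≫ (Bicategory.rightUnitor (app a)).inv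
       simpa using nat_id a
     naturality_comp := fun {a b c} f g => by
       change (nat (f ≫ g)).hom ≫ app a ◁ 𝟙 (f ≫ g) = 𝟙 (f ≫ g) ▷ app c ≫
         (Bicategory.associator f g (app c)).hom ≫ f ◁ (nat g).hom ≫
         (Bicategory.associator f (app b) g).inv ≫ (nat f).hom ▷ g ≫
         (Bicategory.associator (app a) f g).hom
       simpa using nat_comp f g }, isUnitary_nat⟩

/-- A morphism of `Ω(Z₀(S))` from its components. -/
def homMk {φ ψ : LoopZCenter0 S} (t : ∀ a, φ.app a ⟶ ψ.app a)
    (h : ∀ {a b : S} (f : a ⟶ b), f ◁ t b ≫ (ψ.nat f).hom = (φ.nat f).hom ≫ t a ▷ f) : φ ⟶ ψ :=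
  ObjectProperty.homMk ⟨{ app := t, naturality := h }⟩

/-- An isomorphism of `Ω(Z₀(S))` from its components. -/
def isoMk {φ ψ : LoopZCenter0 S} (t : ∀ a, φ.app a ≅ ψ.app a)
    (h : ∀ {a b : S} (f : a ⟶ b),
      f ◁ (t b).hom ≫ (ψ.nat f).hom = (φ.nat f).hom ≫ (t a).hom ▷ f) : φ ≅ ψ :=
  ObjectProperty.isoMk _ (Pseudofunctor.StrongTrans.isoMk t h)

@[simp] theorem homApp_homMk {φ ψ : LoopZCenter0 S} (t : ∀ a, φ.app a ⟶ ψ.app a) (h) (a : S) :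
    homApp (homMk (φ := φ) (ψ := ψ) t h) a = t a := rfl

@[simp] theorem homApp_isoMk_hom {φ ψ : LoopZCenter0 S} (t : ∀ a, φ.app a ≅ ψ.app a) (h) (a : S) :
    homApp (isoMk (φ := φ) (ψ := ψ) t h).hom a = (t a).hom := rfl

@[simp] theorem homApp_id (φ : LoopZCenter0 S) (a : S) : homApp (𝟙 φ) a = 𝟙 _ := rfl

@[simp] theorem homApp_comp {φ ψ χ : LoopZCenter0 S} (Γ : φ ⟶ ψ) (Λ : ψ ⟶ χ) (a : S) :
    homApp (Γ ≫ Λ) a = homApp Γ a ≫ homApp Λ a := rfl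

theorem tensor_nat (φ ψ : LoopZCenter0 S) {a b : S} (f : a ⟶ b) :
    ((φ ⊗ ψ : LoopZCenter0 S).nat f).hom =
      (Bicategory.associator f (φ.app b) (ψ.app b)).inv ≫ (φ.nat f).hom ▷ ψ.app b ≫
        (Bicategory.associator (φ.app a) f (ψ.app b)).hom ≫ φ.app a ◁ (ψ.nat f).hom ≫
        (Bicategory.associator (φ.app a) (ψ.app a) f).inv :=
  Pseudofunctor.StrongTrans.categoryStruct_comp_naturality_hom φ.obj ψ.obj f

/-- The component at `a` of the braiding `φ ⊗ ψ ≅ ψ ⊗ φ` is the naturality 2-isomorphism of `ψ` at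
the 1-morphism `φ.app a : a ⟶ a`. -/
def braiding (φ ψ : LoopZCenter0 S) : (φ ⊗ ψ : LoopZCenter0 S) ≅ ψ ⊗ φ :=
  isoMk (φ := φ ⊗ ψ) (ψ := ψ ⊗ φ) (fun a => ψ.nat (φ.app a)) (fun {a b} f => by
    rw [tensor_nat, tensor_nat]
    change f ◁ (ψ.nat (φ.app b)).hom ≫ (Bicategory.associator f (ψ.app b) (φ.app b)).inv ≫
        (ψ.nat f).hom ▷ φ.app b ≫ (Bicategory.associator (ψ.app a) f (φ.app b)).hom ≫
        ψ.app a ◁ (φ.nat f).hom ≫ (Bicategory.associator (ψ.app a) (φ.app a) f).inv =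
      ((Bicategory.associator f (φ.app b) (ψ.app b)).inv ≫ (φ.nat f).hom ▷ ψ.app b ≫
        (Bicategory.associator (φ.app a) f (ψ.app b)).hom ≫ φ.app a ◁ (ψ.nat f).hom ≫
        (Bicategory.associator (φ.app a) (ψ.app a) f).inv) ≫ (ψ.nat (φ.app a)).hom ▷ f
    have h := ψ.nat_naturality (φ.nat f).hom
    rw [nat_comp, nat_comp] at h
    have h' := congrArg (fun t => (Bicategory.associator f (φ.app b) (ψ.app b)).inv ≫ t ≫
      (Bicategory.associator (ψ.app a) (φ.app a) f).inv) h
    simp only [Category.assoc, Iso.inv_hom_id_assoc, Iso.hom_inv_id, Category.comp_id] at h'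
    simp only [Category.assoc]
    exact h'.symm)

theorem cancel_aux {C : Type*} [Category* C] {a b c d e f : C} (i : a ≅ b) (x : a ⟶ c) (y : c ⟶ d)
    (z : d ⟶ e) (j : f ≅ e) : i.hom ≫ (i.inv ≫ x ≫ y ≫ z ≫ j.inv) ≫ j.hom = x ≫ y ≫ z := by
  simp

/-- `Ω(Z₀(S))` is a braided monoidal category. -/
instance : BraidedCategory (LoopZCenter0 S) where
  braiding φ ψ := braiding φ ψ
  braiding_naturality_right φ ψ χ Γ := by
    ext a
    exact homApp_naturality Γ (φ.app a)
  braiding_naturality_left Γ χ := by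
    ext a
    exact nat_naturality χ (homApp Γ a)
  hexagon_forward φ ψ χ := by
    ext a
    change (Bicategory.associator (φ.app a) (ψ.app a) (χ.app a)).hom ≫
      ((ψ ⊗ χ : LoopZCenter0 S).nat (φ.app a)).hom ≫
        (Bicategory.associator (ψ.app a) (χ.app a) (φ.app a)).hom =
      (ψ.nat (φ.app a)).hom ▷ χ.app a ≫
        (Bicategory.associator (ψ.app a) (φ.app a) (χ.app a)).hom ≫
        ψ.app a ◁ (χ.nat (φ.app a)).hom
    rw [tensor_nat]
    exact cancel_aux _ _ _ _ _
  hexagon_reverse φ ψ χ := by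
    ext a
    change (Bicategory.associator (φ.app a) (ψ.app a) (χ.app a)).inv ≫
      (χ.nat (φ.app a ≫ ψ.app a)).hom ≫
        (Bicategory.associator (χ.app a) (φ.app a) (ψ.app a)).inv =
      φ.app a ◁ (χ.nat (ψ.app a)).hom ≫
        (Bicategory.associator (φ.app a) (χ.app a) (ψ.app a)).inv ≫
        (χ.nat (φ.app a)).hom ▷ ψ.app a
    rw [nat_comp]
    simp

end LoopZCenter0

end

namespace LoopZCenter0

variable {S : Type*} [Bicategory S] [UnitaryBicategory S]

/-! `Ω(Z₀(S))` is a unitary category, with all operations taken componentwise. -/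

instance : Preadditive (LoopZCenter0 S) :=
  inferInstanceAs (Preadditive
    (unitaryTrans (ZCenter0.one S).pseudo (ZCenter0.one S).pseudo).FullSubcategory)

instance : Linear ℂ (LoopZCenter0 S) :=
  inferInstanceAs (Linear ℂ
    (unitaryTrans (ZCenter0.one S).pseudo (ZCenter0.one S).pseudo).FullSubcategory)

instance : UnitaryCategory (LoopZCenter0 S) :=
  inferInstanceAs (UnitaryCategory
    (unitaryTrans (ZCenter0.one S).pseudo (ZCenter0.one S).pseudo).FullSubcategory)

theorem homApp_add {φ ψ : LoopZCenter0 S} (Γ Λ : φ ⟶ ψ) (a : S) :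
    homApp (Γ + Λ) a = homApp Γ a + homApp Λ a := rfl

theorem homApp_smul {φ ψ : LoopZCenter0 S} (r : ℂ) (Γ : φ ⟶ ψ) (a : S) :
    homApp (r • Γ) a = r • homApp Γ a := rfl

theorem homApp_dag {φ ψ : LoopZCenter0 S} (Γ : φ ⟶ ψ) (a : S) :
    homApp (dag Γ) a = dag (homApp Γ a) := rfl

end LoopZCenter0

end

section

open scoped Pseudofunctor.StrongTrans
open scoped MonoidalCategory.MonoidalRightAction
open Functor.LaxRightLinear Functor.OplaxRightLinear

variable {P : Type u} [Category.{v} P] [Preadditive P] [Linear ℂ P] [UnitaryCategory P]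
  [MonoidalCategory P]

/-! ### The Drinfeld center -/

section

open scoped MonoidalCategory
open MonoidalCategory

namespace UnitaryMultiFusion

variable [UnitaryMultiFusion P]

theorem isUnitary_whiskerLeft (p : P) {q r : P} {f : q ⟶ r} (hf : IsUnitary f) :
    IsUnitary (p ◁ f) :=
  ⟨by rw [dag_whiskerLeft, ← whiskerLeft_comp, hf.comp_dag, whiskerLeft_id],
   by rw [dag_whiskerLeft, ← whiskerLeft_comp, hf.dag_comp, whiskerLeft_id]⟩

theorem isUnitary_whiskerRight {q r : P} {f : q ⟶ r} (hf : IsUnitary f) (p : P) :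
    IsUnitary (f ▷ p) :=
  ⟨by rw [dag_whiskerRight, ← comp_whiskerRight, hf.comp_dag, id_whiskerRight],
   by rw [dag_whiskerRight, ← comp_whiskerRight, hf.dag_comp, id_whiskerRight]⟩

end UnitaryMultiFusion

open UnitaryMultiFusion

namespace Center

variable [MonoidalPreadditive P] [MonoidalLinear ℂ P] {z w : Center P}

instance : Add (z ⟶ w) where
  add f g := ⟨f.f + g.f, fun p => by
    rw [MonoidalPreadditive.add_whiskerRight, MonoidalPreadditive.whiskerLeft_add,
      Preadditive.add_comp, Preadditive.comp_add, f.comm, g.comm]⟩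

instance : Zero (z ⟶ w) where
  zero := ⟨0, fun p => by simp⟩

instance : SMul ℂ (z ⟶ w) where
  smul c f := ⟨c • f.f, fun p => by
    rw [MonoidalLinear.smul_whiskerRight, MonoidalLinear.whiskerLeft_smul,
      Linear.smul_comp, Linear.comp_smul, f.comm]⟩

instance : Neg (z ⟶ w) where
  neg f := (-1 : ℂ) • f

@[simp] theorem add_f (f g : z ⟶ w) : (f + g).f = f.f + g.f := rfl

@[simp] theorem zero_f : (0 : z ⟶ w).f = 0 := rfl

@[simp] theorem smul_f (c : ℂ) (f : z ⟶ w) : (c • f).f = c • f.f := rfl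

@[simp] theorem neg_f (f : z ⟶ w) : (-f).f = -f.f := by
  change (-1 : ℂ) • f.f = _
  simp

instance : AddCommGroup (z ⟶ w) where
  add_assoc a b c := by ext; simp [add_assoc]
  zero_add a := by ext; simp
  add_zero a := by ext; simp
  neg_add_cancel a := by ext; simp
  add_comm a b := by ext; simp [add_comm]
  nsmul := nsmulRec
  zsmul := zsmulRec

instance : Preadditive (Center P) where
  add_comp _ _ _ a b c := by ext; exact Preadditive.add_comp _ _ _ _ _ _
  comp_add _ _ _ a b c := by ext; exact Preadditive.comp_add _ _ _ _ _ _

instance : Module ℂ (z ⟶ w) where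
  one_smul a := by ext; simp
  mul_smul c d a := by ext; simp [mul_smul]
  smul_zero c := by ext; simp
  smul_add c a b := by ext; simp
  add_smul c d a := by ext; simp [add_smul]
  zero_smul a := by ext; simp

instance : Linear ℂ (Center P) where
  smul_comp _ _ _ c a b := by ext; exact Linear.smul_comp _ _ _ _ _ _
  comp_smul _ _ _ a c b := by ext; exact Linear.comp_smul _ _ _ _ _ _

end Center

variable (P) in
/-- A half-braiding is unitary if all its components are unitary. -/
def unitaryHalfBraiding : ObjectProperty (Center P) :=
  fun z => ∀ p : P, IsUnitary (z.2.β p).hom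

variable [UnitaryMultiFusion P]

instance : (unitaryHalfBraiding P).IsMonoidal where
  prop_unit p := by
    rw [Center.tensorUnit_β]
    exact (isUnitary_leftUnitor p).comp (isUnitary_rightUnitor p).symm
  prop_tensor z w hz hw p := by
    rw [Center.tensor_β]
    exact (isUnitary_associator _ _ _).comp ((isUnitary_whiskerLeft _ (hw p)).comp
      ((isUnitary_associator _ _ _).symm.comp ((isUnitary_whiskerRight (hz p) _).comp
        (isUnitary_associator _ _ _))))

variable (P) in
/-- The Drinfeld center `Z₁(P)` of a unitary multi-fusion category, as a braided monoidal category: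
its objects are objects of `P` with a unitary half-braiding `z ⊗ p ≅ p ⊗ z`. -/
abbrev DrinfeldCenter := (unitaryHalfBraiding P).FullSubcategory

instance : UnitaryCategory (DrinfeldCenter P) where
  dag {z w} f := ObjectProperty.homMk ⟨dag f.hom.f, fun p => by
    have h := congrArg dag (f.hom.comm p)
    rw [UnitaryCategory.dag_comp, UnitaryCategory.dag_comp, dag_whiskerLeft,
      dag_whiskerRight] at h
    have hz := z.property p
    have hw := w.property p
    calc
      dag f.hom.f ▷ p ≫ (z.obj.2.β p).hom = (w.obj.2.β p).hom ≫ (dag (w.obj.2.β p).hom ≫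
          dag f.hom.f ▷ p) ≫ (z.obj.2.β p).hom := by
        rw [← Category.assoc, ← Category.assoc, hw.comp_dag, Category.id_comp]
      _ = _ := by rw [h, Category.assoc, hz.dag_comp, Category.comp_id]⟩
  dag_dag f := by ext; exact dag_dag _
  dag_id z := by ext; exact UnitaryCategory.dag_id _
  dag_comp f g := by ext; exact UnitaryCategory.dag_comp _ _
  dag_add f g := by ext; exact UnitaryCategory.dag_add _ _
  dag_smul r f := by ext; exact UnitaryCategory.dag_smul _ _
  dag_pos f h := by
    ext
    exact dag_pos _ (congrArg (fun t => t.hom.f) h)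

end

/-! ### The functor from the Drinfeld center to the looping -/

section

open MonoidalCategory MonoidalRightAction

variable [UnitaryMultiFusion P]

instance : UnitaryRightAction P P where
  isUnitaryFunctor_left p :=
    ⟨fun f g => MonoidalPreadditive.whiskerLeft_add f g,
     fun a f => MonoidalLinear.whiskerLeft_smul p a f,
     fun f => (UnitaryMultiFusion.dag_whiskerLeft p f).symm⟩
  isUnitaryFunctor_right p :=
    ⟨fun f g => MonoidalPreadditive.add_whiskerRight f g,
     fun a f => MonoidalLinear.smul_whiskerRight a f p,
     fun f => (UnitaryMultiFusion.dag_whiskerRight f p).symm⟩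
  isUnitary_assoc p q r := (UnitaryMultiFusion.isUnitary_associator p q r).symm
  isUnitary_unit p := UnitaryMultiFusion.isUnitary_rightUnitor p

variable (P) in
/-- `P` as a right module over itself. -/
def RModCat.regular : RModCat P where
  carrier := P

theorem Center.halfBraiding_unit {C : Type*} [Category* C] [MonoidalCategory C] {z : C}
    (b : HalfBraiding z) : (b.β (𝟙_ C)).hom ≫ (λ_ z).hom = (ρ_ z).hom := by
  have h := b.naturality (λ_ (𝟙_ C)).hom
  rw [b.monoidal] at h
  have h1 : (α_ (𝟙_ C) (𝟙_ C) z).inv ≫ (λ_ (𝟙_ C)).hom ▷ z = (λ_ (𝟙_ C ⊗ z)).hom := by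
    monoidal
  simp only [Category.assoc] at h
  rw [h1, leftUnitor_naturality, ← Category.assoc, ← Category.assoc, ← Category.assoc,
    cancel_mono] at h
  have h2 : (b.β (𝟙_ C)).hom ▷ 𝟙_ C ≫ (λ_ z).hom ▷ 𝟙_ C = (ρ_ z).hom ▷ 𝟙_ C := by
    rw [← cancel_epi (α_ z (𝟙_ C) (𝟙_ C)).inv]
    have h3 : (α_ z (𝟙_ C) (𝟙_ C)).inv ≫ (ρ_ z).hom ▷ 𝟙_ C = z ◁ (λ_ (𝟙_ C)).hom := by
      rw [Iso.inv_comp_eq, triangle]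
    have h4 : (λ_ z).hom ▷ 𝟙_ C = (α_ (𝟙_ C) z (𝟙_ C)).hom ≫ (λ_ (z ⊗ 𝟙_ C)).hom := by monoidal
    rw [h3, h, h4]
    simp only [Category.assoc]
  rw [← comp_whiskerRight] at h2
  exact (whiskerRight_iff _ _).1 h2

/-- The structure isomorphism `(x ⊙ z) ⊙ p ≅ (x ⊙ p) ⊙ z` given by the half-braiding
`z ⊗ p ≅ p ⊗ z`. -/
def actByμ (z : DrinfeldCenter P) (X : RModCat P) (x : X.carrier) (p : P) :
    (x ⊙ᵣ z.obj.1) ⊙ᵣ p ≅ (x ⊙ᵣ p) ⊙ᵣ z.obj.1 :=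
  (αᵣ x z.obj.1 p).symm ≪≫ (actionLeft P x).mapIso (z.obj.2.β p) ≪≫ αᵣ x p z.obj.1

theorem actByμ_hom (z : DrinfeldCenter P) (X : RModCat P) (x : X.carrier) (p : P) :
    (actByμ z X x p).hom =
      (αᵣ x z.obj.1 p).inv ≫ x ⊴ᵣ (z.obj.2.β p).hom ≫ (αᵣ x p z.obj.1).hom := rfl

theorem actByμ_assoc (z : DrinfeldCenter P) (X : RModCat P) (x : X.carrier) (p q : P) :
    (actByμ z X x (p ⊗ q)).hom ≫ (αᵣ x p q).hom ⊵ᵣ z.obj.1 =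
      (αᵣ (x ⊙ᵣ z.obj.1) p q).hom ≫ (actByμ z X x p).hom ⊵ᵣ q ≫
        (actByμ z X (x ⊙ᵣ p) q).hom := by
  have hA : ∀ a b c : P, (αᵣ x a (b ⊗ c)).inv ≫ x ⊴ᵣ (α_ a b c).inv ≫ (αᵣ x (a ⊗ b) c).hom =
      (αᵣ (x ⊙ᵣ a) b c).hom ≫ (αᵣ x a b).inv ⊵ᵣ c := by
    intro a b c
    rw [← cancel_mono ((αᵣ x a b).hom ⊵ᵣ c)]
    simp only [Category.assoc]
    rw [← actionHom_associator, actionHomRight_inv_hom_assoc, Iso.inv_hom_id_assoc,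
      inv_hom_actionHomLeft, Category.comp_id]
  have hB : ∀ a b c : P, (αᵣ x (a ⊗ b) c).inv ≫ x ⊴ᵣ (α_ a b c).hom =
      (αᵣ x a b).hom ⊵ᵣ c ≫ (αᵣ (x ⊙ᵣ a) b c).inv ≫ (αᵣ x a (b ⊗ c)).inv := by
    intro a b c
    rw [Iso.inv_comp_eq, ← Category.assoc, ← Category.assoc, Iso.eq_comp_inv, Iso.eq_comp_inv]
    simp only [Category.assoc, actionHom_associator]
  have hC : ∀ a b c : P, x ⊴ᵣ (α_ a b c).inv ≫ (αᵣ x (a ⊗ b) c).hom ≫ (αᵣ x a b).hom ⊵ᵣ c =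
      (αᵣ x a (b ⊗ c)).hom ≫ (αᵣ (x ⊙ᵣ a) b c).hom := by
    intro a b c
    rw [← actionHom_associator, actionHomRight_inv_hom_assoc]
  simp only [actByμ_hom, HalfBraiding.monoidal, actionHomRight_comp, Category.assoc,
    actionHomRight_whiskerRight, hC]
  rw [reassoc_of% hA, reassoc_of% hB]
  simp

/-- The module functor `x ↦ x ⊙ z` attached to an object `(z, β)` of the Drinfeld center, with the
module structure given by `β`. -/
def actBy (z : DrinfeldCenter P) (X : RModCat P) : X ⟶ X where
  functor := actionRight X.carrier z.obj.1
  unitary := UnitaryRightAction.isUnitaryFunctor_right z.obj.1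
  rightLinear := rightLinearOfIso (actionRight X.carrier z.obj.1) (actByμ z X)
    (fun x p q f => by
      change (x ⊙ᵣ z.obj.1) ⊴ᵣ f ≫ (actByμ z X x q).hom =
        (actByμ z X x p).hom ≫ (x ⊴ᵣ f) ⊵ᵣ z.obj.1
      simp only [actByμ_hom, action_actionHomRight, Category.assoc, Iso.hom_inv_id_assoc]
      rw [← actionHomRight_comp_assoc, HalfBraiding.naturality]
      simp)
    (fun {x y} f p => by
      change (f ⊵ᵣ z.obj.1) ⊵ᵣ p ≫ (actByμ z X y p).hom =
        (actByμ z X x p).hom ≫ (f ⊵ᵣ p) ⊵ᵣ z.obj.1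
      simp only [actByμ_hom, Category.assoc]
      have h := action_exchange f (z.obj.2.β p).hom
      simp only [actionHomLeft_tensor, Category.assoc] at h
      rw [← cancel_epi (αᵣ x z.obj.1 p).hom, ← reassoc_of% h]
      simp)
    (fun x p q => actByμ_assoc z X x p q)
    (fun x => by
      change (ρᵣ (x ⊙ᵣ z.obj.1)).hom = (actByμ z X x (𝟙_ P)).hom ≫ (ρᵣ x).hom ⊵ᵣ z.obj.1
      rw [actByμ_hom, Category.assoc, Category.assoc, ← actionHom_leftUnitor,
        ← actionHomRight_comp, Center.halfBraiding_unit, actionHom_rightUnitor,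
        Iso.inv_hom_id_assoc])
  isUnitary_μ x p :=
    ((UnitaryRightAction.isUnitary_assoc x z.obj.1 p).symm).comp
      (((z.property p).actionHomRight x).comp (UnitaryRightAction.isUnitary_assoc x p z.obj.1))

end

section

open MonoidalCategory MonoidalRightAction

variable [UnitaryMultiFusion P]

theorem actBy_μ (z : DrinfeldCenter P) (X : RModCat P) (x : X.carrier) (p : P) :
    μᵣ (actBy z X).functor x p = (αᵣ x z.obj.1 p).inv ≫ x ⊴ᵣ (z.obj.2.β p).hom ≫
      (αᵣ x p z.obj.1).hom := rfl

/-- Module functors commute with `- ⊙ z`, by their module structure. -/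
def actByNat (z : DrinfeldCenter P) {X Y : RModCat P} (G : X ⟶ Y) :
    G ≫ actBy z Y ≅ actBy z X ≫ G :=
  ModFunctor.isoMk (F := ModFunctor.comp G (actBy z Y)) (G := ModFunctor.comp (actBy z X) G)
    (fun x => Functor.RightLinear.μᵣIso G.functor x z.obj.1)
    (fun f => μᵣ_naturality_left G.functor f z.obj.1)
    (fun x p => by
      rw [ModFunctor.comp_μ, ModFunctor.comp_μ, actBy_μ, actBy_μ]
      change (((αᵣ (G.functor.obj x) z.obj.1 p).inv ≫ G.functor.obj x ⊴ᵣ (z.obj.2.β p).hom ≫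
          (αᵣ (G.functor.obj x) p z.obj.1).hom) ≫ (μᵣ G.functor x p ⊵ᵣ z.obj.1)) ≫
          μᵣ G.functor (x ⊙ᵣ p) z.obj.1 =
        μᵣ G.functor x z.obj.1 ⊵ᵣ p ≫ μᵣ G.functor (x ⊙ᵣ z.obj.1) p ≫
          G.functor.map ((αᵣ x z.obj.1 p).inv ≫ x ⊴ᵣ (z.obj.2.β p).hom ≫ (αᵣ x p z.obj.1).hom)
      rw [G.functor.map_comp, G.functor.map_comp, μᵣ_associativity_inv_assoc,
        ← μᵣ_naturality_right_assoc, μᵣ_associativity]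
      simp only [Category.assoc])

theorem actByNat_hom_app (z : DrinfeldCenter P) {X Y : RModCat P} (G : X ⟶ Y) (x : X.carrier) :
    (actByNat z G).hom.nat.app x = μᵣ G.functor x z.obj.1 := rfl

/-- The object `{X ⟶ X, x ↦ x ⊙ z}` of `Ω(Z₀(ΣP))` attached to `(z, β)`. -/
def actObj (z : DrinfeldCenter P) : LoopZCenter0 (RModCat P) :=
  LoopZCenter0.mk (fun X => actBy z X) (fun G => actByNat z G)
    (fun {X Y F G} t => ModNatTrans.hom_ext fun x => (t.comm x z.obj.1).symm)
    (fun X => ModNatTrans.hom_ext fun x => by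
      change 𝟙 (x ⊙ᵣ z.obj.1) = 𝟙 _ ≫ 𝟙 _
      simp)
    (fun {X Y Z} F G => ModNatTrans.hom_ext fun x => by
      change μᵣ G.functor (F.functor.obj x) z.obj.1 ≫ G.functor.map (μᵣ F.functor x z.obj.1) =
        𝟙 _ ≫ μᵣ G.functor (F.functor.obj x) z.obj.1 ≫ 𝟙 _ ≫
          G.functor.map (μᵣ F.functor x z.obj.1) ≫ 𝟙 _
      simp)
    (fun {X Y} G => ModFunctor.isUnitary_of_app fun x => G.isUnitary_μ x z.obj.1)

/-- The module natural transformation `x ⊙ f : x ⊙ z ⟶ x ⊙ w` attached to a morphism `f : z ⟶ w`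
of the Drinfeld center. -/
def actByMap {z w : DrinfeldCenter P} (f : z ⟶ w) (X : RModCat P) : actBy z X ⟶ actBy w X :=
  ModNatTrans.mk (F := actBy z X) (G := actBy w X)
    { app := fun x => x ⊴ᵣ f.hom.f
      naturality := fun x y t => (action_exchange t f.hom.f).symm }
    (fun x p => by
      rw [actBy_μ, actBy_μ]
      change ((αᵣ x z.obj.1 p).inv ≫ x ⊴ᵣ (z.obj.2.β p).hom ≫ (αᵣ x p z.obj.1).hom) ≫
          (x ⊙ᵣ p) ⊴ᵣ f.hom.f =
        (x ⊴ᵣ f.hom.f) ⊵ᵣ p ≫ (αᵣ x w.obj.1 p).inv ≫ x ⊴ᵣ (w.obj.2.β p).hom ≫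
          (αᵣ x p w.obj.1).hom
      have h := congrArg (fun t => x ⊴ᵣ t) (f.hom.comm p)
      simp only [actionHomRight_comp, actionHomRight_whiskerRight, Category.assoc] at h
      rw [← cancel_epi (αᵣ x z.obj.1 p).hom, reassoc_of% h]
      simp)

variable (P) in
/-- The functor `Z₁(P) ⥤ Ω(Z₀(ΣP))`, `(z, β) ↦ {X ⟶ X, x ↦ x ⊙ z}`. -/
def actFunctor : DrinfeldCenter P ⥤ LoopZCenter0 (RModCat P) where
  obj z := actObj z
  map {z w} f := LoopZCenter0.homMk (φ := actObj z) (ψ := actObj w) (fun X => actByMap f X)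
    (fun {X Y} G => ModNatTrans.hom_ext fun x => (μᵣ_naturality_right G.functor x f.hom.f))
  map_id z := LoopZCenter0.hom_ext fun X => ModNatTrans.hom_ext fun x =>
    actionHomRight_id z.obj.1 x
  map_comp f g := LoopZCenter0.hom_ext fun X => ModNatTrans.hom_ext fun x =>
    actionHomRight_comp x f.hom.f g.hom.f

end

section

open MonoidalCategory MonoidalRightAction

/-- A half-braiding on `F 1` from compatible families `F x ⊗ p ≅ F (x ⊗ p)` and
`F (p ⊗ x) ≅ p ⊗ F x`. -/
@[simps]
def halfBraidingOfBilinear {C : Type*} [Category* C] [MonoidalCategory C] (F : C ⥤ C)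
    (m : ∀ x p : C, F.obj x ⊗ p ≅ F.obj (x ⊗ p)) (n : ∀ p x : C, F.obj (p ⊗ x) ≅ p ⊗ F.obj x)
    (m_right : ∀ (x : C) {p q : C} (f : p ⟶ q),
      F.obj x ◁ f ≫ (m x q).hom = (m x p).hom ≫ F.map (x ◁ f))
    (m_left : ∀ {x y : C} (f : x ⟶ y) (p : C),
      F.map f ▷ p ≫ (m y p).hom = (m x p).hom ≫ F.map (f ▷ p))
    (m_assoc : ∀ x p q : C, (m x (p ⊗ q)).hom ≫ F.map (α_ x p q).inv =
      (α_ (F.obj x) p q).inv ≫ (m x p).hom ▷ q ≫ (m (x ⊗ p) q).hom)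
    (n_right : ∀ (p : C) {x y : C} (f : x ⟶ y),
      F.map (p ◁ f) ≫ (n p y).hom = (n p x).hom ≫ p ◁ F.map f)
    (n_left : ∀ {p q : C} (f : p ⟶ q) (x : C),
      F.map (f ▷ x) ≫ (n q x).hom = (n p x).hom ≫ f ▷ F.obj x)
    (n_tensor : ∀ p q x : C, (n (p ⊗ q) x).hom =
      F.map (α_ p q x).hom ≫ (n p (q ⊗ x)).hom ≫ p ◁ (n q x).hom ≫ (α_ p q (F.obj x)).inv)
    (mn : ∀ p x q : C, (m (p ⊗ x) q).hom ≫ F.map (α_ p x q).hom ≫ (n p (x ⊗ q)).hom =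
      (n p x).hom ▷ q ≫ (α_ p (F.obj x) q).hom ≫ p ◁ (m x q).hom) :
    HalfBraiding (F.obj (𝟙_ C)) where
  β p := m (𝟙_ C) p ≪≫ F.mapIso (λ_ p ≪≫ (ρ_ p).symm) ≪≫ n p (𝟙_ C)
  monoidal p q := by
    have hα : (λ_ (p ⊗ q)).hom ≫ (ρ_ (p ⊗ q)).inv ≫ (α_ p q (𝟙_ C)).hom =
        (α_ (𝟙_ C) p q).inv ≫ ((λ_ p).hom ≫ (ρ_ p).inv) ▷ q ≫ (α_ p (𝟙_ C) q).hom ≫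
          p ◁ ((λ_ q).hom ≫ (ρ_ q).inv) := by monoidal
    have h1 : ∀ {y : C} (t : F.obj (p ⊗ q ⊗ 𝟙_ C) ⟶ y),
        F.map (λ_ (p ⊗ q)).hom ≫ F.map (ρ_ (p ⊗ q)).inv ≫ F.map (α_ p q (𝟙_ C)).hom ≫ t =
        F.map (α_ (𝟙_ C) p q).inv ≫ F.map (((λ_ p).hom ≫ (ρ_ p).inv) ▷ q) ≫
          F.map (α_ p (𝟙_ C) q).hom ≫ F.map (p ◁ ((λ_ q).hom ≫ (ρ_ q).inv)) ≫ t := by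
      intro y t
      have h := congrArg (fun s => F.map s ≫ t) hα
      simp only [F.map_comp, Category.assoc] at h
      simpa only [F.map_comp, Category.assoc] using h
    simp only [Iso.trans_hom, Functor.mapIso_hom, Iso.symm_hom, n_tensor, Category.assoc,
      Functor.map_comp]
    rw [h1, reassoc_of% m_assoc, reassoc_of% n_right, ← reassoc_of% m_left, reassoc_of% mn]
    simp
  naturality {p q} f := by
    simp only [Iso.trans_hom, Functor.mapIso_hom, Iso.symm_hom, Category.assoc,
      Functor.map_comp]
    rw [reassoc_of% m_right, ← n_left]
    simp only [← Functor.map_comp_assoc]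
    simp

variable [UnitaryMultiFusion P]

/-- The functor `p ⊗ -` is right linear for the right multiplication, via the associator. -/
@[reducible]
def tensorLeftRightLinear (p : P) : (tensorLeft p).RightLinear P :=
  rightLinearOfIso (tensorLeft p) (fun x q => α_ p x q)
    (fun x q r f => (associator_naturality_right p x f))
    (fun f q => (associator_naturality_middle p f q))
    (fun x q r => by
      change (α_ p x (q ⊗ r)).hom ≫ p ◁ (α_ x q r).inv =
        (α_ (p ⊗ x) q r).inv ≫ (α_ p x q).hom ▷ r ≫ (α_ p (x ⊗ q) r).hom
      monoidal)
    (fun x => by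
      change (ρ_ (p ⊗ x)).hom = (α_ p x (𝟙_ P)).hom ≫ p ◁ (ρ_ x).hom
      monoidal)

theorem isUnitaryFunctor_tensorLeft (p : P) : IsUnitaryFunctor (tensorLeft p) :=
  ⟨fun f g => MonoidalPreadditive.whiskerLeft_add f g,
   fun a f => MonoidalLinear.whiskerLeft_smul p a f,
   fun f => (UnitaryMultiFusion.dag_whiskerLeft p f).symm⟩

/-- The module functor `x ↦ p ⊗ x` on the regular module. -/
def leftMul (p : P) : RModCat.regular P ⟶ RModCat.regular P :=
  ModFunctor.mk (X := RModCat.regular P) (Y := RModCat.regular P) (@tensorLeft P _ _ p)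
    (isUnitaryFunctor_tensorLeft p) (rightLinear := tensorLeftRightLinear p)
    (fun x q => UnitaryMultiFusion.isUnitary_associator (P := P) p x q)

/-- The module natural transformation `p ⊗ x ⟶ q ⊗ x` attached to `f : p ⟶ q`. -/
def leftMulMap {p q : P} (f : p ⟶ q) : leftMul p ⟶ leftMul q :=
  ModNatTrans.mk (F := leftMul p) (G := leftMul q)
    ((tensoringLeft P).map f) (fun x r => (associator_naturality_left f x r).symm)

/-- The module natural isomorphism `p ⊗ (q ⊗ x) ≅ (p ⊗ q) ⊗ x`. -/
def leftMulComp (p q : P) : leftMul q ≫ leftMul p ⟶ leftMul (p ⊗ q) :=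
  ModNatTrans.mk (F := ModFunctor.comp (leftMul q) (leftMul p)) (G := leftMul (p ⊗ q))
    { app := fun x => (α_ p q x).inv
      naturality := fun x y f => associator_inv_naturality_right (C := P) p q f }
    (fun x r => by
      change ((α_ p (q ⊗ x) r).hom ≫ p ◁ (α_ q x r).hom) ≫ (α_ p q (x ⊗ r)).inv =
        (α_ p q x).inv ▷ r ≫ (α_ (p ⊗ q) x r).hom
      monoidal)

namespace LoopZCenter0

variable (φ : LoopZCenter0 (RModCat P))

/-- The underlying functor of the component of `φ` at the regular module `P`. -/
def evFunctorAux : P ⥤ P := (φ.app (RModCat.regular P)).functor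

/-- The module structure `φ x ⊗ p ≅ φ (x ⊗ p)` of the component of `φ` at `P`. -/
def evM (x p : P) : φ.evFunctorAux.obj x ⊗ p ≅ φ.evFunctorAux.obj (x ⊗ p) :=
  Functor.RightLinear.μᵣIso (φ.app (RModCat.regular P)).functor
    x p

/-- The isomorphism `φ (p ⊗ x) ≅ p ⊗ φ x` given by the naturality of `φ` at the module functor
`p ⊗ -`. -/
def evN (p x : P) : φ.evFunctorAux.obj (p ⊗ x) ≅ p ⊗ φ.evFunctorAux.obj x where
  hom := (φ.nat (leftMul p)).hom.nat.app x
  inv := (φ.nat (leftMul p)).inv.nat.app x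
  hom_inv_id := congrArg (fun t => ModNatTrans.nat t |>.app x) (φ.nat (leftMul p)).hom_inv_id
  inv_hom_id := congrArg (fun t => ModNatTrans.nat t |>.app x) (φ.nat (leftMul p)).inv_hom_id

theorem evN_tensor (p q x : P) : (φ.evN (p ⊗ q) x).hom =
      φ.evFunctorAux.map (α_ p q x).hom ≫ (φ.evN p (q ⊗ x)).hom ≫ p ◁ (φ.evN q x).hom ≫
        (α_ p q (φ.evFunctorAux.obj x)).inv := by
  have h := congrArg (fun t => ModNatTrans.nat t |>.app x) (φ.nat_naturality (leftMulComp p q))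
  rw [nat_comp] at h
  have h' : φ.evFunctorAux.map (α_ p q x).inv ≫ (φ.evN (p ⊗ q) x).hom =
    (𝟙 _ ≫ (φ.evN p (q ⊗ x)).hom ≫ 𝟙 _ ≫ p ◁ (φ.evN q x).hom ≫ 𝟙 _) ≫
        (α_ p q (φ.evFunctorAux.obj x)).inv := h
  simp only [Category.id_comp, Category.assoc] at h'
  rw [← h', ← Functor.map_comp_assoc]
  simp

/-- The half-braiding on `φ_P(1)`, with component at `p` the composition
`φ_P(1) ⊗ p ≅ φ_P(1 ⊗ p) ≅ φ_P(p ⊗ 1) ≅ p ⊗ φ_P(1)` of the module structure of `φ_P` and the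
naturality of `φ` at `p ⊗ -`. -/
def evBraiding : HalfBraiding (φ.evFunctorAux.obj (𝟙_ P)) :=
  halfBraidingOfBilinear φ.evFunctorAux φ.evM φ.evN
    (fun x p q f => μᵣ_naturality_right (φ.app (RModCat.regular P)).functor
      x f)
    (fun {x y} f p => μᵣ_naturality_left (φ.app (RModCat.regular P)).functor
      f p)
    (fun x p q => μᵣ_associativity (φ.app (RModCat.regular P)).functor
      x p q)
    (fun p x y f => (φ.nat (leftMul p)).hom.nat.naturality f)
    (fun {p q} f x => congrArg (fun t => ModNatTrans.nat t |>.app x)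
      (φ.nat_naturality (leftMulMap f)))
    φ.evN_tensor
    (fun p x q => (Category.assoc _ _ _).symm.trans ((φ.nat (leftMul p)).hom.comm x q))

end LoopZCenter0

end

section

open MonoidalCategory MonoidalRightAction

variable [UnitaryMultiFusion P]

namespace LoopZCenter0

theorem evBraiding_β_hom (φ : LoopZCenter0 (RModCat P)) (p : P) : (φ.evBraiding.β p).hom =
    (φ.evM (𝟙_ P) p).hom ≫ φ.evFunctorAux.map ((λ_ p).hom ≫ (ρ_ p).inv) ≫
      (φ.evN p (𝟙_ P)).hom := rfl

theorem isUnitary_evBraiding (φ : LoopZCenter0 (RModCat P)) (p : P) :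
    IsUnitary (φ.evBraiding.β p).hom := by
  rw [evBraiding_β_hom]
  have hn := φ.isUnitary_nat (leftMul p)
  have hn' : IsUnitary (φ.evN p (𝟙_ P)).hom :=
    ⟨congrArg (fun t => ModNatTrans.nat t |>.app (𝟙_ P)) hn.comp_dag,
     congrArg (fun t => ModNatTrans.nat t |>.app (𝟙_ P)) hn.dag_comp⟩
  have hF : IsUnitaryFunctor φ.evFunctorAux := (φ.app (RModCat.regular P)).unitary
  exact ((φ.app (RModCat.regular P)).isUnitary_μ (𝟙_ P) p).comp
    ((hF.map_isUnitary ((UnitaryMultiFusion.isUnitary_leftUnitor p).comp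
      (UnitaryMultiFusion.isUnitary_rightUnitor p).symm)).comp hn')

/-- The component at `x : P` of the component at the regular module of a morphism of
`Ω(Z₀(ΣP))`. -/
def evHom {φ ψ : LoopZCenter0 (RModCat P)} (Γ : φ ⟶ ψ) (x : P) :
    φ.evFunctorAux.obj x ⟶ ψ.evFunctorAux.obj x :=
  (homApp Γ (RModCat.regular P)).nat.app x

theorem evHom_naturality {φ ψ : LoopZCenter0 (RModCat P)} (Γ : φ ⟶ ψ) {x y : P} (f : x ⟶ y) :
    φ.evFunctorAux.map f ≫ evHom Γ y = evHom Γ x ≫ ψ.evFunctorAux.map f :=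
  (homApp Γ (RModCat.regular P)).nat.naturality f

theorem evHom_comm {φ ψ : LoopZCenter0 (RModCat P)} (Γ : φ ⟶ ψ) (x p : P) :
    (φ.evM x p).hom ≫ evHom Γ (x ⊗ p) = evHom Γ x ▷ p ≫ (ψ.evM x p).hom :=
  (homApp Γ (RModCat.regular P)).comm x p

theorem evHom_evN {φ ψ : LoopZCenter0 (RModCat P)} (Γ : φ ⟶ ψ) (p x : P) :
    evHom Γ (p ⊗ x) ≫ (ψ.evN p x).hom = (φ.evN p x).hom ≫ p ◁ evHom Γ x :=
  congrArg (fun t => ModNatTrans.nat t |>.app x) (homApp_naturality Γ (leftMul p))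

variable (P) in
/-- The functor `Ω(Z₀(ΣP)) ⥤ Z₁(P)`, `φ ↦ φ_P(1)`. -/
def evFunctor : LoopZCenter0 (RModCat P) ⥤ DrinfeldCenter P where
  obj φ := ⟨⟨φ.evFunctorAux.obj (𝟙_ P), φ.evBraiding⟩, φ.isUnitary_evBraiding⟩
  map {φ ψ} Γ := ObjectProperty.homMk ⟨evHom Γ (𝟙_ P), fun p => by
    change evHom Γ (𝟙_ P) ▷ p ≫ (ψ.evBraiding.β p).hom =
      (φ.evBraiding.β p).hom ≫ p ◁ evHom Γ (𝟙_ P)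
    rw [evBraiding_β_hom, evBraiding_β_hom, Category.assoc, Category.assoc, ← evHom_evN,
      reassoc_of% evHom_naturality, reassoc_of% evHom_comm]⟩
  map_id _ := rfl
  map_comp _ _ := rfl

end LoopZCenter0

end

end

end

open MonoidalCategory MonoidalRightAction

noncomputable section

open Functor.LaxRightLinear Functor.OplaxRightLinear UnitaryCategory

/-! ### Coherence identities for right actions -/

namespace CategoryTheory.MonoidalCategory.MonoidalRightAction

variable {C D : Type*} [Category* C] [Category* D] [MonoidalCategory C] [MonoidalRightAction C D]

/-! The argument is a Yoneda lemma for module categories: the regular module is free on its unit. An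
object `x` of a module `X` gives the module functor `x ⊙ -` (`orbit X x`) from `P` to `X`, and `x ≅
x ⊙ 1` is the image of `1` under it. Naturality of `φ` at this functor therefore yields `φ_X(x) ≅
φ_X(x ⊙ 1) ≅ x ⊙ φ_P(1)`, the isomorphism `evAct`. So `φ` is recovered from the single object
`φ_P(1)`.

What remains is to see that `evAct` respects all structure. The 2-morphisms between orbit functors
supply most of this. Naturality of `φ` at `orbitMap` makes `evAct` natural in `x`. Naturality at
`orbitLeftMul`, which compares `x ⊙ (p ⊗ -)` with `(x ⊙ p) ⊙ -`, brings in the naturality of `φ` at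
`p ⊗ -`, hence the half-braiding, and leads to `evAct_comm`: `evAct` is a module transformation.
Naturality at `orbitComp`, which compares `G x ⊙ -` with `G (x ⊙ -)`, leads to `evAct_comp`: the
transformations for varying `X` form a modification. Naturality in `φ` is the modification axiom at
an orbit functor.

In the other direction, `- ⊙ z` evaluated at the unit of `P` is `1 ⊗ z`, and the left unitor
identifies it with `z`. It is a morphism of the center by pure coherence (`evBraiding_actObj`).

The monoidal axioms are pentagon and triangle identities for the action, and compatibility with a
module functor `G` is the associativity and unitality of its structure. The braiding of the looping
is the naturality of `- ⊙ w` at the module functor `- ⊙ z`, that is, the module structure of `- ⊙ z`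
at `w`, which was defined by the half-braiding. The comparison isomorphisms are unitary because
every constituent is a unitary coherence isomorphism, its image under a unitary functor, or a
unitary naturality isomorphism. -/

theorem actionAssoc_inv_associator_hom (x : D) (a b c : C) :
    (αᵣ x (a ⊗ b) c).inv ≫ x ⊴ᵣ (α_ a b c).hom =
      (αᵣ x a b).hom ⊵ᵣ c ≫ (αᵣ (x ⊙ᵣ a) b c).inv ≫ (αᵣ x a (b ⊗ c)).inv := by
  rw [Iso.inv_comp_eq, ← Category.assoc, ← Category.assoc, Iso.eq_comp_inv, Iso.eq_comp_inv]
  simp only [Category.assoc, actionHom_associator]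

theorem associator_inv_actionAssoc_hom (x : D) (a b c : C) :
    x ⊴ᵣ (α_ a b c).inv ≫ (αᵣ x (a ⊗ b) c).hom =
      (αᵣ x a (b ⊗ c)).hom ≫ (αᵣ (x ⊙ᵣ a) b c).hom ≫ (αᵣ x a b).inv ⊵ᵣ c := by
  rw [← cancel_mono ((αᵣ x a b).hom ⊵ᵣ c)]
  simp only [Category.assoc]
  rw [← actionHom_associator, actionHomRight_inv_hom_assoc, inv_hom_actionHomLeft,
    Category.comp_id]

theorem actionAssoc_hom_naturality_right (x : D) {a b : C} (c : C) (f : a ⟶ b) :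
    (αᵣ x c a).hom ≫ (x ⊙ᵣ c) ⊴ᵣ f = x ⊴ᵣ (c ◁ f) ≫ (αᵣ x c b).hom := by
  simp

theorem actionAssoc_inv_naturality_right (x : D) {a b : C} (c : C) (f : a ⟶ b) :
    (αᵣ x c a).inv ≫ x ⊴ᵣ (c ◁ f) = (x ⊙ᵣ c) ⊴ᵣ f ≫ (αᵣ x c b).inv := by
  simp

theorem actionAssoc_hom_naturality_middle (x : D) {a b : C} (c : C) (f : a ⟶ b) :
    (αᵣ x a c).hom ≫ (x ⊴ᵣ f) ⊵ᵣ c = x ⊴ᵣ (f ▷ c) ≫ (αᵣ x b c).hom := by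
  simp

theorem actionAssoc_inv_naturality_middle (x : D) {a b : C} (c : C) (f : a ⟶ b) :
    (αᵣ x a c).inv ≫ x ⊴ᵣ (f ▷ c) = (x ⊴ᵣ f) ⊵ᵣ c ≫ (αᵣ x b c).inv := by
  simp

theorem actionAssoc_inv_naturality_left {x y : D} (f : x ⟶ y) (a b : C) :
    (αᵣ x a b).inv ≫ f ⊵ᵣ (a ⊗ b) = (f ⊵ᵣ a) ⊵ᵣ b ≫ (αᵣ y a b).inv := by
  simp

/-- For half-braidings `f` and `g`, the left side carries the module structure of the composite `(-
⊙ z) ⊙ w` and the right side that of `- ⊙ (z ⊗ w)`: the bracket acting on `x` is the half-braiding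
of a tensor product in the center. Only pentagons and naturality of the action are needed, so `f`
and `g` may be arbitrary morphisms. -/
theorem action_tensor_exchange (x : D) {z w p : C} (f : z ⊗ p ⟶ p ⊗ z) (g : w ⊗ p ⟶ p ⊗ w) :
    (((αᵣ (x ⊙ᵣ z) w p).inv ≫ (x ⊙ᵣ z) ⊴ᵣ g ≫ (αᵣ (x ⊙ᵣ z) p w).hom) ≫
        ((αᵣ x z p).inv ≫ x ⊴ᵣ f ≫ (αᵣ x p z).hom) ⊵ᵣ w) ≫ (αᵣ (x ⊙ᵣ p) z w).inv =
      (αᵣ x z w).inv ⊵ᵣ p ≫ (αᵣ x (z ⊗ w) p).inv ≫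
        x ⊴ᵣ ((α_ z w p).hom ≫ z ◁ g ≫ (α_ z p w).inv ≫ f ▷ w ≫ (α_ p z w).hom) ≫
          (αᵣ x p (z ⊗ w)).hom := by
  have h : (αᵣ (x ⊙ᵣ z) p w).hom ≫ (αᵣ x z p).inv ⊵ᵣ w =
      (αᵣ x z (p ⊗ w)).inv ≫ x ⊴ᵣ (α_ z p w).inv ≫ (αᵣ x (z ⊗ p) w).hom := by
    rw [associator_inv_actionAssoc_hom, Iso.inv_hom_id_assoc]
  have h' : (αᵣ x p z).hom ⊵ᵣ w ≫ (αᵣ (x ⊙ᵣ p) z w).inv =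
      (αᵣ x (p ⊗ z) w).inv ≫ x ⊴ᵣ (α_ p z w).hom ≫ (αᵣ x p (z ⊗ w)).hom := by
    rw [reassoc_of% actionAssoc_inv_associator_hom, Iso.inv_hom_id, Category.comp_id]
  simp only [actionHomRight_comp, comp_actionHomLeft, Category.assoc]
  -- A pentagon cancels the leading associators on the right, and `g` slides past the next one. On
  -- the left, `h` and `h'` turn the action associators around `f` into associators of `C`, and `f`
  -- slides between them.
  rw [reassoc_of% actionAssoc_inv_associator_hom, inv_hom_actionHomLeft_assoc,
    reassoc_of% actionAssoc_inv_naturality_right, reassoc_of% h, h',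
    reassoc_of% actionAssoc_hom_naturality_middle, Iso.hom_inv_id_assoc]

/-- The half-braiding of the unit of the center is `λ ≫ ρ⁻¹`, so this is what makes `x ≅ x ⊙ 1`
compatible with the module structures. After composing with the unit isomorphism of `x ⊙ p`, the two
unit triangles reduce both sides to the identity. -/
theorem action_unit_exchange (x : D) (p : C) :
    (ρᵣ[C] (x ⊙ᵣ p)).inv = (ρᵣ[C] x).inv ⊵ᵣ p ≫ (αᵣ x (𝟙_ C) p).inv ≫
      x ⊴ᵣ ((λ_ p).hom ≫ (ρ_ p).inv) ≫ (αᵣ x p (𝟙_ C)).hom := by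
  rw [← cancel_mono (ρᵣ[C] (x ⊙ᵣ p)).hom]
  simp only [Category.assoc]
  rw [← actionHom_rightUnitor, ← actionHomRight_comp, Category.assoc, Iso.inv_hom_id,
    Iso.inv_hom_id, Category.comp_id, actionHom_leftUnitor, Iso.inv_hom_id_assoc,
    inv_hom_actionHomLeft]

end CategoryTheory.MonoidalCategory.MonoidalRightAction

variable {P : Type u} [Category.{v} P] [Preadditive P] [Linear ℂ P] [UnitaryCategory P]
  [MonoidalCategory P] [UnitaryMultiFusion P]

/-! ### Unitarity of the functor from the Drinfeld center -/

/-- Sums, scalars and adjoints of modifications and of module transformations are componentwise, so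
everything reduces to unitarity of `x ⊙ -` for each object `x`. -/
theorem isUnitaryFunctor_actFunctor : IsUnitaryFunctor (actFunctor P) where
  map_add f g := LoopZCenter0.hom_ext fun X => ModNatTrans.hom_ext fun x =>
    (UnitaryRightAction.isUnitaryFunctor_left (P := P) x).map_add f.hom.f g.hom.f
  map_smul a f := LoopZCenter0.hom_ext fun X => ModNatTrans.hom_ext fun x =>
    (UnitaryRightAction.isUnitaryFunctor_left (P := P) x).map_smul a f.hom.f
  map_dag f := LoopZCenter0.hom_ext fun X => ModNatTrans.hom_ext fun x =>
    (UnitaryRightAction.isUnitaryFunctor_left (P := P) x).map_dag f.hom.f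

/-! ### The monoidal structure of the functor from the Drinfeld center -/

/-- The module natural isomorphism `(x ⊙ z) ⊙ w ≅ x ⊙ (z ⊗ w)`. -/
def actByTensor (z w : DrinfeldCenter P) (X : RModCat P) :
    actBy z X ≫ actBy w X ≅ actBy (z ⊗ w) X :=
  ModFunctor.isoMk (F := ModFunctor.comp (actBy z X) (actBy w X)) (G := actBy (z ⊗ w) X)
    (fun x => (αᵣ x z.obj.1 w.obj.1).symm)
    (fun {x y} f => by
      change (f ⊵ᵣ z.obj.1) ⊵ᵣ w.obj.1 ≫ (αᵣ y z.obj.1 w.obj.1).inv =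
        (αᵣ x z.obj.1 w.obj.1).inv ≫ f ⊵ᵣ (z.obj.1 ⊗ w.obj.1)
      simp)
    -- The half-braiding of `z ⊗ w` unfolds to the bracketed composite of this identity.
    (fun x p => action_tensor_exchange x (z.obj.2.β p).hom (w.obj.2.β p).hom)

/-- The module natural isomorphism `x ≅ x ⊙ 1`. -/
def actByUnit (X : RModCat P) : 𝟙 X ≅ actBy (𝟙_ (DrinfeldCenter P)) X :=
  ModFunctor.isoMk (F := ModFunctor.id X) (G := actBy (𝟙_ (DrinfeldCenter P)) X)
    (fun x => (ρᵣ[P] x).symm)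
    (fun {x y} f => by
      change f ≫ (ρᵣ[P] y).inv = (ρᵣ[P] x).inv ≫ f ⊵ᵣ (𝟙_ P)
      simp)
    -- The identity functor has identity module structure, which is removed first.
    (fun x p => (Category.id_comp _).trans (action_unit_exchange x p))

variable (P) in
/-- The monoidal structure on `(z, β) ↦ - ⊙ z`. -/
def actFunctorCoreMonoidal : (actFunctor P).CoreMonoidal where
  εIso := LoopZCenter0.isoMk (φ := 𝟙_ (LoopZCenter0 (RModCat P)))
    (ψ := actObj (𝟙_ (DrinfeldCenter P))) (fun X => actByUnit X)
    (fun {X Y} G => ModNatTrans.hom_ext fun x => by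
      change (ρᵣ[P] (G.functor.obj x)).inv ≫ μᵣ G.functor x (𝟙_ P) =
        (𝟙 _ ≫ 𝟙 _) ≫ G.functor.map (ρᵣ[P] x).inv
      -- The unit object's naturality at `G` is built from unitors of `ΣP`, whose components are
      -- identities. What is left is the unit axiom of the module functor `G`.
      rw [Category.comp_id, Category.id_comp, μᵣ_unitality_inv])
  μIso z w := LoopZCenter0.isoMk (φ := actObj z ⊗ actObj w) (ψ := actObj (z ⊗ w))
    (fun X => actByTensor z w X)
    (fun {X Y} G => ModNatTrans.hom_ext fun x => by
      rw [LoopZCenter0.tensor_nat]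
      change (αᵣ (G.functor.obj x) z.obj.1 w.obj.1).inv ≫ μᵣ G.functor x (z.obj.1 ⊗ w.obj.1) =
        (𝟙 _ ≫ (μᵣ G.functor x z.obj.1) ⊵ᵣ w.obj.1 ≫ 𝟙 _ ≫
          μᵣ G.functor (x ⊙ᵣ z.obj.1) w.obj.1 ≫ 𝟙 _) ≫ G.functor.map (αᵣ x z.obj.1 w.obj.1).inv
      -- The identities are components of associators of `ΣP`. The modification condition is then
      -- the associativity axiom of `G`.
      simp only [Category.id_comp, Category.comp_id, Category.assoc, μᵣ_associativity_inv])
  μIso_hom_natural_left {z z'} f w := LoopZCenter0.hom_ext fun X => ModNatTrans.hom_ext fun x => by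
    change (x ⊴ᵣ f.hom.f) ⊵ᵣ w.obj.1 ≫ (αᵣ x z'.obj.1 w.obj.1).inv =
      (αᵣ x z.obj.1 w.obj.1).inv ≫ x ⊴ᵣ (f.hom.f ▷ w.obj.1)
    exact (actionAssoc_inv_naturality_middle x w.obj.1 f.hom.f).symm
  μIso_hom_natural_right {w w'} z f := LoopZCenter0.hom_ext fun X => ModNatTrans.hom_ext fun x => by
    change (x ⊙ᵣ z.obj.1) ⊴ᵣ f.hom.f ≫ (αᵣ x z.obj.1 w'.obj.1).inv =
      (αᵣ x z.obj.1 w.obj.1).inv ≫ x ⊴ᵣ (z.obj.1 ◁ f.hom.f)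
    exact (actionAssoc_inv_naturality_right x z.obj.1 f.hom.f).symm
  associativity z w t := LoopZCenter0.hom_ext fun X => ModNatTrans.hom_ext fun x => by
    change (αᵣ x z.obj.1 w.obj.1).inv ⊵ᵣ t.obj.1 ≫ (αᵣ x (z.obj.1 ⊗ w.obj.1) t.obj.1).inv ≫
        x ⊴ᵣ (α_ z.obj.1 w.obj.1 t.obj.1).hom =
      𝟙 _ ≫ (αᵣ (x ⊙ᵣ z.obj.1) w.obj.1 t.obj.1).inv ≫ (αᵣ x z.obj.1 (w.obj.1 ⊗ t.obj.1)).inv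
    rw [actionAssoc_inv_associator_hom, inv_hom_actionHomLeft_assoc, Category.id_comp]
  left_unitality z := LoopZCenter0.hom_ext fun X => ModNatTrans.hom_ext fun x => by
    change 𝟙 _ = (ρᵣ[P] x).inv ⊵ᵣ z.obj.1 ≫ (αᵣ x (𝟙_ P) z.obj.1).inv ≫ x ⊴ᵣ (λ_ z.obj.1).hom
    rw [actionHom_leftUnitor, Iso.inv_hom_id_assoc, inv_hom_actionHomLeft]
  right_unitality z := LoopZCenter0.hom_ext fun X => ModNatTrans.hom_ext fun x => by
    change 𝟙 _ = (ρᵣ[P] (x ⊙ᵣ z.obj.1)).inv ≫ (αᵣ x z.obj.1 (𝟙_ P)).inv ≫ x ⊴ᵣ (ρ_ z.obj.1).hom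
    rw [actionHom_rightUnitor, Iso.inv_hom_id_assoc, Iso.inv_hom_id]

variable (P) in
/-- The functor `(z, β) ↦ - ⊙ z` is braided monoidal. -/
@[reducible]
def actFunctorBraided : (actFunctor P).Braided where
  toMonoidal := (actFunctorCoreMonoidal P).toMonoidal
  braided z w := LoopZCenter0.hom_ext fun X => ModNatTrans.hom_ext fun x => by
    -- The braiding of the looping is the naturality of `- ⊙ w` at the 1-morphism `- ⊙ z`, hence the
    -- module structure of `- ⊙ z` at `w`. That structure is the half-braiding conjugated by
    -- associators, one of which cancels.
    change (αᵣ x z.obj.1 w.obj.1).inv ≫ x ⊴ᵣ (z.obj.2.β w.obj.1).hom =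
      μᵣ (actBy z X).functor x w.obj.1 ≫ (αᵣ x w.obj.1 z.obj.1).inv
    rw [actBy_μ]
    exact ((Iso.comp_inv_eq _).2 (Category.assoc _ _ _).symm).symm

/-! ### The module functors `x ⊙ -` -/

/-- The functor `p ↦ x ⊙ p` is right linear, via the module associativity. -/
@[reducible]
def actionLeftRightLinear (X : RModCat P) (x : X.carrier) : (actionLeft P x).RightLinear P :=
  rightLinearOfIso (actionLeft P x) (fun q r => (αᵣ x q r).symm)
    (fun q r s f => (actionAssoc_inv_naturality_right x q f).symm)
    (fun f r => (actionAssoc_inv_naturality_middle x r f).symm)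
    (fun q r s => by
      change (αᵣ x q (r ⊗ s)).inv ≫ x ⊴ᵣ (α_ q r s).inv =
        (αᵣ (x ⊙ᵣ q) r s).hom ≫ (αᵣ x q r).inv ⊵ᵣ s ≫ (αᵣ x (q ⊗ r) s).inv
      rw [Iso.inv_comp_eq, ← Category.assoc, ← Category.assoc, Iso.eq_comp_inv,
        associator_inv_actionAssoc_hom, Category.assoc])
    (fun q => by
      change (ρᵣ[P] (x ⊙ᵣ q)).hom = (αᵣ x q (𝟙_ P)).inv ≫ x ⊴ᵣ (ρ_ q).hom
      rw [actionHom_rightUnitor, Iso.inv_hom_id_assoc])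

/-- The module functor `p ↦ x ⊙ p` from the regular module. -/
def orbit (X : RModCat P) (x : X.carrier) : RModCat.regular P ⟶ X :=
  ModFunctor.mk (X := RModCat.regular P) (Y := X) (actionLeft P x)
    (UnitaryRightAction.isUnitaryFunctor_left (P := P) x) (rightLinear := actionLeftRightLinear X x)
    (fun (q r : P) => (UnitaryRightAction.isUnitary_assoc x q r).symm)

/-- The module natural transformation `x ⊙ q ⟶ y ⊙ q` attached to `f : x ⟶ y`. -/
def orbitMap {X : RModCat P} {x y : X.carrier} (f : x ⟶ y) : orbit X x ⟶ orbit X y :=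
  ModNatTrans.mk (F := orbit X x) (G := orbit X y)
    { app := fun (q : P) => f ⊵ᵣ q
      naturality := fun q r t => action_exchange (C := P) f t }
    (fun (q r : P) => actionAssoc_inv_naturality_left f q r)

/-- The module natural transformation `x ⊙ (p ⊗ q) ⟶ (x ⊙ p) ⊙ q`. -/
def orbitLeftMul {X : RModCat P} (x : X.carrier) (p : P) :
    leftMul p ≫ orbit X x ⟶ orbit X (x ⊙ᵣ p) :=
  ModNatTrans.mk (F := ModFunctor.comp (leftMul p) (orbit X x)) (G := orbit X (x ⊙ᵣ p))
    { app := fun (q : P) => (αᵣ x p q).hom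
      naturality := fun q r t => (actionAssoc_hom_naturality_right (C := P) x p t).symm }
    (fun (q r : P) => by
      change ((αᵣ x (p ⊗ q) r).inv ≫ x ⊴ᵣ (α_ p q r).hom) ≫ (αᵣ x p (q ⊗ r)).hom =
        (αᵣ x p q).hom ⊵ᵣ r ≫ (αᵣ (x ⊙ᵣ p) q r).inv
      rw [actionAssoc_inv_associator_hom, Category.assoc, Category.assoc, Iso.inv_hom_id,
        Category.comp_id])

/-- The module natural transformation `G x ⊙ q ⟶ G (x ⊙ q)`. -/
def orbitComp {X Y : RModCat P} (G : X ⟶ Y) (x : X.carrier) :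
    orbit Y (G.functor.obj x) ⟶ orbit X x ≫ G :=
  ModNatTrans.mk (F := orbit Y (G.functor.obj x)) (G := ModFunctor.comp (orbit X x) G)
    { app := fun (q : P) => μᵣ G.functor x q
      naturality := fun q r t => μᵣ_naturality_right (C := P) G.functor x t }
    (fun (q r : P) => by
      change (αᵣ (G.functor.obj x) q r).inv ≫ μᵣ G.functor x (q ⊗ r) =
        μᵣ G.functor x q ⊵ᵣ r ≫ μᵣ G.functor (x ⊙ᵣ q) r ≫ G.functor.map (αᵣ x q r).inv
      -- Associativity of the module structure of `G` is exactly the statement that this structure,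
      -- with `x` fixed, is itself a module transformation.
      rw [μᵣ_associativity_inv])

/-! ### The object `φ_P(1)` acts as `φ` -/

namespace LoopZCenter0

theorem isUnitary_of_homApp {S : Type*} [Bicategory S] [UnitaryBicategory S]
    {φ ψ : LoopZCenter0 S} {Γ : φ ⟶ ψ} (h : ∀ a, IsUnitary (homApp Γ a)) : IsUnitary Γ :=
  ⟨hom_ext fun a => (h a).comp_dag, hom_ext fun a => (h a).dag_comp⟩

variable (φ : LoopZCenter0 (RModCat P)) {X Y : RModCat P}

/-- The component at `x` of the naturality isomorphism of `φ` at a module functor. -/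
def natApp (G : X ⟶ Y) (x : X.carrier) :
    (φ.app Y).functor.obj (G.functor.obj x) ≅ G.functor.obj ((φ.app X).functor.obj x) where
  hom := (φ.nat G).hom.nat.app x
  inv := (φ.nat G).inv.nat.app x
  hom_inv_id := congrArg (fun t => ModNatTrans.nat t |>.app x) (φ.nat G).hom_inv_id
  inv_hom_id := congrArg (fun t => ModNatTrans.nat t |>.app x) (φ.nat G).inv_hom_id

theorem isUnitary_natApp (G : X ⟶ Y) (x : X.carrier) : IsUnitary (φ.natApp G x).hom :=
  ⟨congrArg (fun t => ModNatTrans.nat t |>.app x) (φ.isUnitary_nat G).comp_dag,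
   congrArg (fun t => ModNatTrans.nat t |>.app x) (φ.isUnitary_nat G).dag_comp⟩

theorem natApp_naturality (G : X ⟶ Y) {x y : X.carrier} (f : x ⟶ y) :
    (φ.app Y).functor.map (G.functor.map f) ≫ (φ.natApp G y).hom =
      (φ.natApp G x).hom ≫ G.functor.map ((φ.app X).functor.map f) :=
  (φ.nat G).hom.nat.naturality f

/-- The isomorphism `φ_X(x ⊙ q) ≅ x ⊙ φ_P(q)` given by the naturality of `φ` at `x ⊙ -`. -/
def evOrbit (x : X.carrier) (q : P) :
    (φ.app X).functor.obj (x ⊙ᵣ q) ≅ x ⊙ᵣ φ.evFunctorAux.obj q :=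
  φ.natApp (orbit X x) q

theorem evOrbit_naturality_right (x : X.carrier) {q r : P} (f : q ⟶ r) :
    (φ.app X).functor.map (x ⊴ᵣ f) ≫ (φ.evOrbit x r).hom =
      (φ.evOrbit x q).hom ≫ x ⊴ᵣ φ.evFunctorAux.map f :=
  φ.natApp_naturality (orbit X x) f

/-- A morphism of `X` induces a 2-morphism of orbit functors, and the naturality isomorphisms of `φ`
are natural in 2-morphisms. -/
theorem evOrbit_naturality_left {x y : X.carrier} (f : x ⟶ y) (q : P) :
    (φ.app X).functor.map (f ⊵ᵣ q) ≫ (φ.evOrbit y q).hom =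
      (φ.evOrbit x q).hom ≫ f ⊵ᵣ φ.evFunctorAux.obj q :=
  congrArg (fun t => ModNatTrans.nat t |>.app q) (φ.nat_naturality (orbitMap f))

/-- The naturality isomorphism of `φ` at `x ⊙ -` is a 2-morphism of `ΣP`, so it respects the module
structures of the two composites. -/
theorem evOrbit_comm (x : X.carrier) (q r : P) :
    μᵣ (φ.app X).functor (x ⊙ᵣ q) r ≫ (φ.app X).functor.map (αᵣ x q r).inv ≫
        (φ.evOrbit x (q ⊗ r)).hom =
      (φ.evOrbit x q).hom ⊵ᵣ r ≫ (αᵣ x (φ.evFunctorAux.obj q) r).inv ≫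
        x ⊴ᵣ (φ.evM q r).hom :=
  (Category.assoc _ _ _).symm.trans ((φ.nat (orbit X x)).hom.comm q r)

/-- Naturality of `φ` at the 2-morphism `orbitLeftMul x p`. Its source is a composite, so `nat_comp`
splits the naturality there into the parts at `x ⊙ -` and at `p ⊗ -`; the latter is `evN`. -/
theorem evOrbit_action (x : X.carrier) (p q : P) :
    (φ.app X).functor.map (αᵣ x p q).hom ≫ (φ.evOrbit (x ⊙ᵣ p) q).hom =
      (φ.evOrbit x (p ⊗ q)).hom ≫ x ⊴ᵣ (φ.evN p q).hom ≫
        (αᵣ x p (φ.evFunctorAux.obj q)).hom := by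
  have h := congrArg (fun t => ModNatTrans.nat t |>.app q) (φ.nat_naturality (orbitLeftMul x p))
  rw [nat_comp] at h
  -- The identities stand for the associators of `ΣP` in `nat_comp`.
  have h' : (φ.app X).functor.map (αᵣ x p q).hom ≫ (φ.evOrbit (x ⊙ᵣ p) q).hom =
    (𝟙 _ ≫ (φ.evOrbit x (p ⊗ q)).hom ≫ 𝟙 _ ≫ x ⊴ᵣ (φ.evN p q).hom ≫ 𝟙 _) ≫
        (αᵣ x p (φ.evFunctorAux.obj q)).hom := h
  simpa only [Category.id_comp, Category.comp_id, Category.assoc] using h'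

/-- Naturality of `φ` at `orbitComp G x`, with `nat_comp` applied to its composite target. -/
theorem evOrbit_comp (G : X ⟶ Y) (x : X.carrier) (q : P) :
    (φ.app Y).functor.map (μᵣ G.functor x q) ≫ (φ.natApp G (x ⊙ᵣ q)).hom ≫
        G.functor.map (φ.evOrbit x q).hom =
      (φ.evOrbit (G.functor.obj x) q).hom ≫ μᵣ G.functor x (φ.evFunctorAux.obj q) := by
  have h := congrArg (fun t => ModNatTrans.nat t |>.app q) (φ.nat_naturality (orbitComp G x))
  rw [nat_comp] at h
  have h' : (φ.app Y).functor.map (μᵣ G.functor x q) ≫ (𝟙 _ ≫ (φ.natApp G (x ⊙ᵣ q)).hom ≫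
        𝟙 _ ≫ G.functor.map (φ.evOrbit x q).hom ≫ 𝟙 _) =
      (φ.evOrbit (G.functor.obj x) q).hom ≫ μᵣ G.functor x (φ.evFunctorAux.obj q) := h
  simpa only [Category.id_comp, Category.comp_id, Category.assoc] using h'

theorem evOrbit_hom {φ ψ : LoopZCenter0 (RModCat P)} (Γ : φ ⟶ ψ) (x : X.carrier) (q : P) :
    (homApp Γ X).nat.app (x ⊙ᵣ q) ≫ (ψ.evOrbit x q).hom =
      (φ.evOrbit x q).hom ≫ x ⊴ᵣ evHom Γ q :=
  congrArg (fun t => ModNatTrans.nat t |>.app q) (homApp_naturality Γ (orbit X x))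

/-- The isomorphism `φ_X(x) ≅ x ⊙ φ_P(1)`. -/
def evAct (x : X.carrier) : (φ.app X).functor.obj x ≅ x ⊙ᵣ φ.evFunctorAux.obj (𝟙_ P) :=
  (φ.app X).functor.mapIso (ρᵣ[P] x).symm ≪≫ φ.evOrbit x (𝟙_ P)

theorem evAct_hom (x : X.carrier) : (φ.evAct x).hom =
    (φ.app X).functor.map (ρᵣ[P] x).inv ≫ (φ.evOrbit x (𝟙_ P)).hom := rfl

theorem isUnitary_evAct (x : X.carrier) : IsUnitary (φ.evAct x).hom :=
  ((φ.app X).unitary.map_isUnitary (UnitaryRightAction.isUnitary_unit x).symm).comp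
    (φ.isUnitary_natApp (orbit X x) (𝟙_ P))

theorem evAct_naturality {x y : X.carrier} (f : x ⟶ y) :
    (φ.app X).functor.map f ≫ (φ.evAct y).hom =
      (φ.evAct x).hom ≫ f ⊵ᵣ φ.evFunctorAux.obj (𝟙_ P) := by
  rw [evAct_hom, evAct_hom, Category.assoc, ← evOrbit_naturality_left, ← Functor.map_comp_assoc,
    ← Functor.map_comp_assoc, actionUnitIso_inv_naturality]

/-- This is where the half-braiding on `φ_P(1)` has to be the one given. Its three factors are
matched by `evOrbit_comm` at `q = 1`, by naturality in the argument of `P` for the unitors, and by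
`evOrbit_action`. -/
theorem evAct_comm (x : X.carrier) (p : P) :
    μᵣ (φ.app X).functor x p ≫ (φ.evAct (x ⊙ᵣ p)).hom =
      (φ.evAct x).hom ⊵ᵣ p ≫ (αᵣ x (φ.evFunctorAux.obj (𝟙_ P)) p).inv ≫
        x ⊴ᵣ (φ.evBraiding.β p).hom ≫ (αᵣ x p (φ.evFunctorAux.obj (𝟙_ P))).hom := by
  -- The left side inserts a unit after `p`, the right side before it. `action_unit_exchange`
  -- expresses the former through the latter and `λ ≫ ρ⁻¹`.
  rw [evAct_hom, evAct_hom, evBraiding_β_hom, comp_actionHomLeft, actionHomRight_comp,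
    actionHomRight_comp, action_unit_exchange]
  rw [(φ.app X).functor.map_comp, (φ.app X).functor.map_comp, (φ.app X).functor.map_comp]
  simp only [Category.assoc]
  rw [← reassoc_of% φ.evOrbit_comm x (𝟙_ P) p, μᵣ_naturality_left_assoc,
    ← reassoc_of% evOrbit_naturality_right, ← evOrbit_action]

/-- The isomorphism `φ_X ≅ - ⊙ φ_P(1)` of module functors. -/
def evActIso (X : RModCat P) : φ.app X ≅ actBy ((evFunctor P).obj φ) X :=
  ModFunctor.isoMk (F := φ.app X) (G := actBy ((evFunctor P).obj φ) X) (fun x => φ.evAct x)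
    (fun f => φ.evAct_naturality f) (fun x p => φ.evAct_comm x p)

/-- The modification condition for `evActIso` at `G`. It follows from `evOrbit_comp` at the unit,
since unitality of `G` matches the unit inserted at `G x` with the image of the one inserted at `x`.
-/
theorem evAct_comp (G : X ⟶ Y) (x : X.carrier) :
    (φ.evAct (G.functor.obj x)).hom ≫ μᵣ G.functor x (φ.evFunctorAux.obj (𝟙_ P)) =
      (φ.natApp G x).hom ≫ G.functor.map (φ.evAct x).hom := by
  rw [evAct_hom, evAct_hom, Category.assoc, ← evOrbit_comp, G.functor.map_comp,
    ← reassoc_of% natApp_naturality, ← Functor.map_comp_assoc, μᵣ_unitality_inv]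

theorem evAct_homApp {φ ψ : LoopZCenter0 (RModCat P)} (Γ : φ ⟶ ψ) (x : X.carrier) :
    (homApp Γ X).nat.app x ≫ (ψ.evAct x).hom = (φ.evAct x).hom ≫ x ⊴ᵣ evHom Γ (𝟙_ P) := by
  rw [evAct_hom, evAct_hom, Category.assoc, ← evOrbit_hom, reassoc_of% ModNatTrans.naturality]

variable (P) in
/-- The natural isomorphism `φ ≅ {- ⊙ φ_P(1)}`. -/
def counitIso : evFunctor P ⋙ actFunctor P ≅ 𝟭 (LoopZCenter0 (RModCat P)) :=
  (NatIso.ofComponents (F := 𝟭 _) (G := evFunctor P ⋙ actFunctor P)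
    (fun φ => isoMk (φ := φ) (ψ := actObj ((evFunctor P).obj φ)) φ.evActIso
      (fun {X Y} G => ModNatTrans.hom_ext fun x => φ.evAct_comp G x))
    (fun {φ ψ} Γ => hom_ext fun X => ModNatTrans.hom_ext fun x => evAct_homApp Γ x)).symm

theorem isUnitary_counitIso (φ : LoopZCenter0 (RModCat P)) :
    IsUnitary ((counitIso P).hom.app φ) :=
  -- The counit is the inverse of the family `evAct`, so unitarity is checked on the inverse.
  IsUnitary.symm (e := (counitIso P).symm.app φ) <| isUnitary_of_homApp fun X =>
    ModFunctor.isUnitary_of_app fun x => φ.isUnitary_evAct x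

/-! ### The half-braiding on `1 ⊗ z` -/

/-- This makes the left unitor `1 ⊗ z ⟶ z` a morphism of the center. -/
theorem evBraiding_actObj (z : DrinfeldCenter P) (p : P) :
    (λ_ z.obj.1).hom ▷ p ≫ (z.obj.2.β p).hom =
      ((actObj z).evBraiding.β p).hom ≫ p ◁ (λ_ z.obj.1).hom := by
  rw [evBraiding_β_hom]
  -- The action associator of the regular module is the inverse of that of `P`. The naturality of `-
  -- ⊙ z` at `p ⊗ -` is the module structure of `p ⊗ -`, an associator. With everything unfolded,
  -- the half-braiding enters as an opaque morphism and coherence suffices.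
  change _ = (((α_ (𝟙_ P) z.obj.1 p).hom ≫ 𝟙_ P ◁ (z.obj.2.β p).hom ≫ (α_ (𝟙_ P) p z.obj.1).inv) ≫
    ((λ_ p).hom ≫ (ρ_ p).inv) ▷ z.obj.1 ≫ (α_ p (𝟙_ P) z.obj.1).hom) ≫ p ◁ (λ_ z.obj.1).hom
  monoidal

variable (P) in
/-- The natural isomorphism `1 ⊗ z ≅ z`. -/
def unitIso : actFunctor P ⋙ evFunctor P ≅ 𝟭 (DrinfeldCenter P) :=
  NatIso.ofComponents
    (fun z => ObjectProperty.isoMk _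
      (@Center.isoMk P _ _ ((evFunctor P).obj (actObj z)).obj z.obj
        ⟨(λ_ z.obj.1).hom, evBraiding_actObj z⟩ (inferInstanceAs (IsIso (λ_ z.obj.1).hom))))
    (fun {z w} f => by
      ext
      exact leftUnitor_naturality f.hom.f)

theorem isUnitary_unitIso (z : DrinfeldCenter P) : IsUnitary ((unitIso P).hom.app z) :=
  ⟨by ext; exact (UnitaryMultiFusion.isUnitary_leftUnitor z.obj.1).comp_dag,
   by ext; exact (UnitaryMultiFusion.isUnitary_leftUnitor z.obj.1).dag_comp⟩

end LoopZCenter0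

/-! ### The equivalence and the final statement -/

theorem actFunctor_isEquivalence : (actFunctor P).IsEquivalence :=
  (CategoryTheory.Equivalence.mk (actFunctor P) (LoopZCenter0.evFunctor P)
    (LoopZCenter0.unitIso P).symm (LoopZCenter0.counitIso P)).isEquivalence_functor

end

/-- The two component formulas determine the tensor and unit comparisons of the braided structure,
since morphisms of the looping are determined by their components. The half-braiding on `φ_P(1)` is
part of the definition of `evFunctor`. -/
theorem mainTheorem2 {P : Type u} [Category.{v} P] [Preadditive P] [Linear ℂ P]
    [UnitaryCategory P] [MonoidalCategory P] [UnitaryMultiFusion P] :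
    (actFunctor P).IsEquivalence ∧
    IsUnitaryFunctor (actFunctor P) ∧
    (∃ _ : (actFunctor P).Braided,
      (∀ (z w : DrinfeldCenter P) (X : RModCat P) (x : X.carrier),
        (LoopZCenter0.homApp (Functor.LaxMonoidal.μ (actFunctor P) z w) X).nat.app x =
          (αᵣ x z.obj.1 w.obj.1).inv) ∧
      (∀ (X : RModCat P) (x : X.carrier),
        (LoopZCenter0.homApp (Functor.LaxMonoidal.ε (actFunctor P)) X).nat.app x = (ρᵣ[P] x).inv)) ∧
    (∃ e : actFunctor P ⋙ LoopZCenter0.evFunctor P ≅ 𝟭 (DrinfeldCenter P),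
      ∀ z, IsUnitary (e.hom.app z)) ∧
    (∃ e : LoopZCenter0.evFunctor P ⋙ actFunctor P ≅ 𝟭 (LoopZCenter0 (RModCat P)),
      ∀ φ, IsUnitary (e.hom.app φ)) :=
  ⟨actFunctor_isEquivalence, isUnitaryFunctor_actFunctor,
    ⟨actFunctorBraided P, fun _ _ _ _ => rfl, fun _ _ => rfl⟩,
    ⟨LoopZCenter0.unitIso P, LoopZCenter0.isUnitary_unitIso⟩,
    ⟨LoopZCenter0.counitIso P, LoopZCenter0.isUnitary_counitIso⟩⟩
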